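/- Let $c>0$. For $w\in\mathbb C\setminus[-2\sqrt c,2\sqrt c]$ let $\sqrt{w^2-4c}$ denote the holomorphic branch with $\sqrt{w^2-4c}\sim w$ as $w\to\infty$, and put $\rho(w)=\frac12\bigl(-w+\sqrt{w^2-4c}\bigr)$. For $\alpha\in\mathbb R$ and $\beta>0$ let $$S_{\alpha,\beta}(w)=\frac{1}{\alpha-w-2\beta\rho(w)}=\frac{\alpha-(1-\beta)w+\beta\sqrt{w^2-4c}}{G_0(w)},\qquad G_0(w)=\alpha^2+4c\beta^2-2\alpha(1-\beta)w+(1-2\beta)w^2 .$$ Given $a,b\in\mathbb C$, a positive solution for $(w-a)(w-b)$ is a pair $(\alpha,\beta)$ with $\alpha\in\mathbb R$, $\beta>0$ such that $G_0$ is a nonzero constant multiple of $(w-a)(w-b)$. The Stieltjes transform of a finite measure $\mu$ on $\mathbb R$ is $S_\mu(w)=\int_{\mathbb R}\frac{\mu(dt)}{t-w}$ ($w\in\mathbb C\setminus\mathbb R$); equalities of transforms below are meant on $\mathbb C\setminus\mathbb R$. **Proposition.** Let $(w-a)(w-b)$ be a real quadratic polynomial ($a+b,ab\in\mathbb R$)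 such that $Q(t)=N(t-a)(t-b)>0$ on $(-2\sqrt c,2\sqrt c)$ for some real $N$, and suppose that not $a=b=\pm2\sqrt c$. Then the measure $\frac{\sqrt{4c-t^2}}{Q(t)}\,dt$ on $(-2\sqrt c,2\sqrt c)$ can be normalized to a probability measure $\mu$, and there is exactly one positive solution $(\alpha,\beta)$ with $S_{\alpha,\beta}=S_\mu$. Moreover: 1. If the roots $a,b$ are not real, there is no other positive solution. 2. If $a,b$ are real with $a\ne b$ and $a^2\neq4c$, $b^2\ne4c$, there is exactly one other positive solution if $ab>0$, and there are exactly three other positive solutions if $ab<0$. 3. In the degenerate real cases there is no other positive solution if $a=b$, or if $ab>0$ and one of $a^2,b^2$ equals $4c$, or if $a^2=b^2=4c$; there is exactly one other if $ab<0$ and exactly one of $a^2,b^2$ equals $4c$. 4. For every positive solution $(\alpha,\beta)$ with $S_{\alpha,\beta}\neq S_\mu$, $S_{\alpha,\beta}$ is the Stieltjes transform of a probability measure $\kappa\mu+u\delta_a+v\delta_b$ with $\kappa>0$, $u,v\ge0$ and $u+v>0$, i.e. of a measure with atoms. -/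

import Mathlib

open Polynomial MeasureTheory
open scoped NNReal

namespace SemicircularShift

/-- The branch of `√(w² - 4c)` that is holomorphic on `ℂ ∖ [-2√c, 2√c]` and behaves like `w` at
infinity: the product of the principal roots of `w - 2√c` and `w + 2√c`. -/
noncomputable def semiSqrt (c : ℝ) (w : ℂ) : ℂ :=
  (w - 2 * (√c : ℝ)) ^ (1 / 2 : ℂ) * (w + 2 * (√c : ℝ)) ^ (1 / 2 : ℂ)

/-- The semicircular root `ρ`: the root of `z² + w z + c` that vanishes at `w = ∞`. -/
noncomputable def rho (c : ℝ) (w : ℂ) : ℂ :=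
  (-w + semiSqrt c w) / 2

/-- The shift of a function `S` with parameters `α`, `β`. -/
noncomputable def shift (α β : ℂ) (S : ℂ → ℂ) (w : ℂ) : ℂ :=
  1 / (α - w - β * S w)

/-- The one-step shift `S_{α,β}` of `2ρ`. -/
noncomputable def oneShift (c : ℝ) (α β : ℂ) : ℂ → ℂ :=
  shift α β (fun w => 2 * rho c w)

/-- The denominator `G₀` in `S_{α,β} = (F₀ + β √(w² - 4c)) / G₀`, where
`F₀ = α - (1 - β) w`; see `oneShift_eq`. -/
noncomputable def denom (c : ℝ) (α β : ℂ) : ℂ[X] :=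
  C (α ^ 2 + 4 * c * β ^ 2) - C (2 * α * (1 - β)) * X + C (1 - 2 * β) * X ^ 2

/-- `(α, β)` with `α` real and `β > 0` is a positive one-shift solution for the quadratic
`(w - a)(w - b)` if the denominator of `S_{α,β}` is proportional to it. -/
def IsPositiveSolution (c : ℝ) (a b : ℂ) (p : ℝ × ℝ) : Prop :=
  0 < p.2 ∧ ∃ k : ℂ, k ≠ 0 ∧ denom c p.1 p.2 = C k * ((X - C a) * (X - C b))

/-- The Stieltjes transform `S_μ(w) = ∫ μ(dt) / (t - w)`, for `w ∈ ℂ ∖ ℝ`. -/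
noncomputable def stieltjes (μ : Measure ℝ) (w : ℂ) : ℂ :=
  resolventTransform μ w

theorem stieltjes_eq (μ : Measure ℝ) (w : ℂ) :
    stieltjes μ w = ∫ t : ℝ, 1 / ((t : ℂ) - w) ∂μ := by
  simp [stieltjes, resolventTransform_apply, resolvent]

/-- `S_{α,β} = S_μ` as functions on `ℂ ∖ ℝ`. -/
def Represents (c : ℝ) (p : ℝ × ℝ) (μ : Measure ℝ) : Prop :=
  ∀ w : ℂ, w.im ≠ 0 → oneShift c p.1 p.2 w = stieltjes μ w

/-- The value `Q(t) = N (t - a)(t - b)` at a real `t`, for a real quadratic polynomial `Q`. -/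
noncomputable def quad (N : ℝ) (a b : ℂ) (t : ℝ) : ℝ :=
  N * (((t : ℂ) - a) * ((t : ℂ) - b)).re

/-- The measure `√(4c - t²) / Q(t) dt` on `(-2√c, 2√c)`, where `Q(t) = N (t - a)(t - b)`. -/
noncomputable def rawMeasure (c N : ℝ) (a b : ℂ) : Measure ℝ :=
  (volume.restrict (Set.Ioo (-(2 * √c)) (2 * √c))).withDensity
    (fun t => ENNReal.ofReal (√(4 * c - t ^ 2) / quad N a b t))

/-- The measure `√(4c - t²) / Q(t) dt`, normalized to total mass one. -/
noncomputable def quadMeasure (c N : ℝ) (a b : ℂ) : Measure ℝ :=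
  (rawMeasure c N a b Set.univ)⁻¹ • rawMeasure c N a b

/-- The positive one-shift solutions with `S_{α,β} ≠ S_μ`. -/
def extraSolutions (c : ℝ) (a b : ℂ) (μ : Measure ℝ) : Set (ℝ × ℝ) :=
  {p | IsPositiveSolution c a b p ∧ ¬ Represents c p μ}

theorem semiSqrt_sq (c : ℝ) (hc : 0 ≤ c) (w : ℂ) : semiSqrt c w ^ 2 = w ^ 2 - 4 * c := by
  have h : ((√c : ℝ) : ℂ) ^ 2 = c := by rw [← Complex.ofReal_pow, Real.sq_sqrt hc]
  have e : ∀ z : ℂ, (z ^ (1 / 2 : ℂ)) ^ 2 = z := fun z => by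
    simp
  rw [semiSqrt, mul_pow, e, e]
  linear_combination (-4) * h

theorem oneShift_eq (c : ℝ) (hc : 0 ≤ c) (α β w : ℂ) (hw : (denom c α β).eval w ≠ 0) :
    oneShift c α β w =
      (α - (1 - β) * w + β * semiSqrt c w) / (denom c α β).eval w := by
  have h := semiSqrt_sq c hc w
  have key : (denom c α β).eval w = (α - w - β * (2 * rho c w)) *
      (α - (1 - β) * w + β * semiSqrt c w) := by
    simp only [denom, rho, eval_add, eval_sub, eval_mul, eval_pow, eval_C, eval_X]
    linear_combination β ^ 2 * h
  rw [key] at hw ⊢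
  rw [oneShift, shift, eq_div_iff hw, one_div, ← mul_assoc,
    inv_mul_cancel₀ (left_ne_zero_of_mul hw), one_mul]

end SemicircularShift

/-! Everything is expressed through `y = ρ(w)`, the root of `z² + w z + c` in the disc of radius
`√c`, where `w = -(y + c / y)`. The denominator `α - w - 2 β y` becomes `(c - y Y₁) (c - y Y₂) / (c
y)` with `Y₁ + Y₂ = -α` and `Y₁ Y₂ = (1 - 2 β) c`. By `isPositiveSolution_iff`, `G₀` is proportional
to `(w - a) (w - b)` exactly when `Y₁`, `Y₂` are roots of `z² + a z + c` and `z² + b z + c`. Each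
quadratic has an inner root `y` and an outer root `c / y`, so there are at most four candidates, and
`β > 0` selects among them. The transform of `μ` is computed from the semicircle integral `2 π y` by
partial fractions (`quadMeasure_spec`). It equals `S_{α,β}` for the pair of inner roots, and a
measure determines its pair (`represents_unique`). For real `a`, `b` the inner roots `y₁`, `y₂` are
real and `β > 0` means `Y₁ Y₂ < c`. Flipping `y₁` alone is allowed iff `y₁ y₂ < y₁ ^ 2`, flipping
both iff `y₁ y₂ < 0`, and `a b` has the sign of `y₁ y₂`; this gives the counts. A flip puts a pole
of the transform at `ρ = yᵢ`, which is an atom at the corresponding root of `Q`. For non-real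
conjugate `a`, `b`, a mixed choice makes `α` non-real and two outer roots make `β ≤ 0`. -/

namespace SemicircularShift

/-! ### Trigonometric integrals over the unit circle -/

open Complex in
theorem one_add_mul_exp_ne_zero {r : ℂ} (hr : ‖r‖ < 1) (θ : ℝ) : 1 + r * exp (θ * I) ≠ 0 := by
  intro h
  have h1 : r * exp (θ * I) = -1 := by linear_combination h
  have h2 : ‖r‖ = 1 := by
    have := congrArg norm h1
    simpa [norm_exp_ofReal_mul_I] using this
  linarith

open Complex in
theorem continuous_inv_one_add_mul_exp {r : ℂ} (hr : ‖r‖ < 1) :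
    Continuous fun θ : ℝ => (1 + r * exp (θ * I))⁻¹ :=
  Continuous.inv₀ (by fun_prop) (one_add_mul_exp_ne_zero hr)

open Complex in
/-- The mean value property of `(1 + r z)⁻ⁿ` on the unit circle. -/
theorem integral_inv_one_add_mul_exp_pow {r : ℂ} (hr : ‖r‖ < 1) (n : ℕ) :
    ∫ θ : ℝ in -Real.pi..Real.pi, ((1 + r * exp (θ * I))⁻¹) ^ n = 2 * Real.pi := by
  have hd : DiffContOnCl ℂ (fun z : ℂ => ((1 + r * z)⁻¹) ^ n) (Metric.ball 0 |(1 : ℝ)|) := by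
    apply DifferentiableOn.diffContOnCl
    intro z hz
    have hz' : ‖z‖ ≤ 1 := by
      simpa using Metric.closure_ball_subset_closedBall hz
    have hne : 1 + r * z ≠ 0 := by
      intro h
      have h1 : r * z = -1 := by linear_combination h
      have h2 : ‖r‖ * ‖z‖ = 1 := by
        have := congrArg norm h1
        simpa using this
      nlinarith [norm_nonneg r, norm_nonneg z]
    exact DifferentiableAt.differentiableWithinAt (by fun_prop (disch := assumption))
  have h := hd.circleAverage
  rw [Real.circleAverage_def] at h
  have hper : Function.Periodic (fun θ : ℝ => ((1 + r * exp (θ * I))⁻¹) ^ n) (2 * Real.pi) := by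
    intro θ
    have : exp (((θ + 2 * Real.pi : ℝ) : ℂ) * I) = exp (θ * I) := by
      push_cast
      rw [add_mul, exp_add, exp_two_pi_mul_I, mul_one]
    simp only [this]
  have h2 := hper.intervalIntegral_add_eq (-Real.pi) 0
  rw [show -Real.pi + 2 * Real.pi = Real.pi by ring, zero_add] at h2
  rw [h2]
  simp only [circleMap, ofReal_one, one_mul, zero_add, mul_zero, add_zero, inv_one, one_pow,
    real_smul] at h
  have hpi : (2 * Real.pi : ℂ) ≠ 0 := by
    simp [Real.pi_ne_zero]
  push_cast at h
  field_simp at h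
  rw [← h]
  simp

theorem integral_add_comp_neg {f : ℝ → ℂ} (hf : Continuous f) (x : ℝ) :
    ∫ θ in (0 : ℝ)..x, (f θ + f (-θ)) = ∫ θ in -x..x, f θ := by
  have hf' : Continuous fun θ => f (-θ) := hf.comp continuous_neg
  rw [intervalIntegral.integral_add (hf.intervalIntegrable _ _)
    (hf'.intervalIntegrable _ _), intervalIntegral.integral_comp_neg (f := f),
    neg_zero, add_comm, intervalIntegral.integral_add_adjacent_intervals
      (hf.intervalIntegrable _ _) (hf.intervalIntegrable _ _)]

open Complex in
/-- `1 + 2 r cos θ + r²` factors over the unit circle. -/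
theorem one_add_mul_cos_add_sq_eq (r : ℂ) (θ : ℝ) :
    1 + 2 * r * Real.cos θ + r ^ 2 =
      (1 + r * exp (θ * I)) * (1 + r * exp ((-θ : ℝ) * I)) := by
  have h : exp (θ * I) * exp ((-θ : ℝ) * I) = 1 := by
    rw [← exp_add]; simp
  rw [ofReal_cos, Complex.cos, ← ofReal_neg]
  linear_combination -r ^ 2 * h

theorem one_add_mul_cos_add_sq_ne_zero {r : ℂ} (hr : ‖r‖ < 1) (θ : ℝ) :
    1 + 2 * r * Real.cos θ + r ^ 2 ≠ 0 := by
  rw [one_add_mul_cos_add_sq_eq]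
  exact mul_ne_zero (one_add_mul_exp_ne_zero hr θ) (one_add_mul_exp_ne_zero hr (-θ))

-- Partial fractions in `exp (θ * I)` split the integrand as `h θ + h (-θ)`, which turns the half
-- period into a full circle. There only the mean values of `g` and of the exponential enter, and
-- these are `1` and `0`.
open Complex in
theorem integral_sin_sq_div_of_norm_lt {r : ℂ} (hr : ‖r‖ < 1) (hr0 : r ≠ 0) :
    ∫ θ : ℝ in (0 : ℝ)..Real.pi, (Real.sin θ : ℂ) ^ 2 / (1 + 2 * r * Real.cos θ + r ^ 2) =
      (Real.pi : ℂ) / 2 := by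
  let g : ℝ → ℂ := fun θ => (1 + r * exp (θ * I))⁻¹
  have hg : Continuous g := continuous_inv_one_add_mul_exp hr
  have he : ∀ θ : ℝ, exp (θ * I) * exp ((-θ : ℝ) * I) = 1 := fun θ => by
    rw [← exp_add]; simp
  have key : ∀ θ : ℝ, (Real.sin θ : ℂ) ^ 2 / (1 + 2 * r * Real.cos θ + r ^ 2) =
      (fun θ : ℝ => (4 * r)⁻¹ * (r⁻¹ * (1 - g θ) + r * g θ - exp ((-θ : ℝ) * I))) θ +
      (fun θ : ℝ => (4 * r)⁻¹ * (r⁻¹ * (1 - g θ) + r * g θ - exp ((-θ : ℝ) * I))) (-θ) := by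
    intro θ
    have h1 := one_add_mul_exp_ne_zero hr θ
    have h2 := one_add_mul_exp_ne_zero hr (-θ)
    have hs : (Real.sin θ : ℂ) = (exp ((-θ : ℝ) * I) - exp (θ * I)) * I / 2 := by
      rw [ofReal_sin, Complex.sin, ofReal_neg]
    rw [one_add_mul_cos_add_sq_eq, hs]
    simp only [g, neg_neg]
    have h3 := he θ
    generalize exp (θ * I) = x at *
    generalize exp ((-θ : ℝ) * I) = y at *
    have hx : x ≠ 0 := left_ne_zero_of_mul_eq_one h3
    obtain rfl : y = x⁻¹ := by field_simp; linear_combination h3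
    have h2' : x + r ≠ 0 := fun h => h2 (by field_simp; simpa using h)
    have h1' : 1 + x * r ≠ 0 := by rwa [mul_comm]
    field_simp
    rw [I_sq]
    ring
  simp_rw [key]
  rw [integral_add_comp_neg (by fun_prop)]
  have hc : ∀ {f : ℝ → ℂ}, Continuous f → IntervalIntegrable f volume (-Real.pi) Real.pi :=
    fun hf => hf.intervalIntegrable _ _
  have hg1 : ∫ θ in -Real.pi..Real.pi, g θ = 2 * Real.pi := by
    simpa using integral_inv_one_add_mul_exp_pow hr 1
  have hexp : ∫ θ : ℝ in -Real.pi..Real.pi, exp ((-θ : ℝ) * I) = 0 := by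
    have := intervalIntegral.integral_comp_neg (a := -Real.pi) (b := Real.pi)
      (f := fun θ : ℝ => exp (θ * I))
    rw [this, neg_neg]
    have h2 := integral_exp_mul_complex (a := -Real.pi) (b := Real.pi) (c := I) I_ne_zero
    simp_rw [mul_comm _ I]
    rw [h2]
    simp [mul_comm I, exp_neg, exp_pi_mul_I]
  rw [intervalIntegral.integral_const_mul, intervalIntegral.integral_sub (hc (by fun_prop))
    (hc (by fun_prop)), intervalIntegral.integral_add (hc (by fun_prop)) (hc (by fun_prop)),
    intervalIntegral.integral_const_mul, intervalIntegral.integral_const_mul,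
    intervalIntegral.integral_sub (hc (by fun_prop)) (hc (by fun_prop)), hg1, hexp]
  simp
  field_simp
  ring

-- The same symmetrization as for the first power; the double pole now also requires the mean value
-- of `g ^ 2`, which is again `1`.
open Complex in
theorem integral_sin_sq_div_sq {r : ℂ} (hr : ‖r‖ < 1) (hr0 : r ≠ 0) :
    ∫ θ : ℝ in (0 : ℝ)..Real.pi, (Real.sin θ : ℂ) ^ 2 / (1 + 2 * r * Real.cos θ + r ^ 2) ^ 2 =
      Real.pi / (2 * (1 - r ^ 2)) := by
  let g : ℝ → ℂ := fun θ => (1 + r * exp (θ * I))⁻¹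
  have hg : Continuous g := continuous_inv_one_add_mul_exp hr
  have he : ∀ θ : ℝ, exp (θ * I) * exp ((-θ : ℝ) * I) = 1 := fun θ => by
    rw [← exp_add]; simp
  have hr2 : 1 - r ^ 2 ≠ 0 := by
    intro h
    have h1 : r ^ 2 = 1 := by linear_combination -h
    have h2 : ‖r‖ ^ 2 = 1 := by rw [← norm_pow, h1, norm_one]
    nlinarith [norm_nonneg r]
  have key : ∀ θ : ℝ, (Real.sin θ : ℂ) ^ 2 / (1 + 2 * r * Real.cos θ + r ^ 2) ^ 2 =
      (fun θ : ℝ => -(4 * r ^ 2)⁻¹ * (g θ ^ 2 - 2 / (1 - r ^ 2) * (g θ - 1 / 2))) θ +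
      (fun θ : ℝ => -(4 * r ^ 2)⁻¹ * (g θ ^ 2 - 2 / (1 - r ^ 2) * (g θ - 1 / 2))) (-θ) := by
    intro θ
    have h1 := one_add_mul_exp_ne_zero hr θ
    have h2 := one_add_mul_exp_ne_zero hr (-θ)
    have hs : (Real.sin θ : ℂ) = (exp ((-θ : ℝ) * I) - exp (θ * I)) * I / 2 := by
      rw [ofReal_sin, Complex.sin, ofReal_neg]
    rw [one_add_mul_cos_add_sq_eq, hs]
    simp only [g]
    have h3 := he θ
    generalize exp (θ * I) = x at *
    generalize exp ((-θ : ℝ) * I) = y at *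
    have hx : x ≠ 0 := left_ne_zero_of_mul_eq_one h3
    obtain rfl : y = x⁻¹ := by field_simp; linear_combination h3
    have h2' : x + r ≠ 0 := fun h => h2 (by field_simp; simpa using h)
    have h1' : 1 + x * r ≠ 0 := by rwa [mul_comm]
    field_simp
    rw [I_sq]
    ring
  simp_rw [key]
  rw [integral_add_comp_neg (by fun_prop)]
  have hc : ∀ {f : ℝ → ℂ}, Continuous f → IntervalIntegrable f volume (-Real.pi) Real.pi :=
    fun hf => hf.intervalIntegrable _ _
  have hg1 : ∫ θ in -Real.pi..Real.pi, g θ = 2 * Real.pi := by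
    simpa using integral_inv_one_add_mul_exp_pow hr 1
  have hg2 : ∫ θ in -Real.pi..Real.pi, g θ ^ 2 = 2 * Real.pi :=
    integral_inv_one_add_mul_exp_pow hr 2
  rw [intervalIntegral.integral_const_mul, intervalIntegral.integral_sub (hc (by fun_prop))
    (hc (by fun_prop)), intervalIntegral.integral_const_mul,
    intervalIntegral.integral_sub (hc (by fun_prop)) (hc (by fun_prop)), hg1, hg2]
  simp
  field_simp
  ring

/-! ### Inner roots and integrals against the semicircle weight -/

/-- `y` is the root of `z² + w z + c` inside the disc of radius `√c`, or a double root `±√c`. -/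
def IsInnerRoot (c : ℝ) (w y : ℂ) : Prop :=
  y ^ 2 + w * y + c = 0 ∧ (‖y‖ < √c ∨ y ^ 2 = c)

theorem IsInnerRoot.ne_zero {c : ℝ} {w y : ℂ} (h : IsInnerRoot c w y) (hc : 0 < c) : y ≠ 0 := by
  rintro rfl
  have := h.1
  simp [hc.ne'] at this

theorem image_cos_Ioo {s : ℝ} (hs : 0 < s) :
    (fun θ => 2 * s * Real.cos θ) '' Set.Ioo 0 Real.pi = Set.Ioo (-(2 * s)) (2 * s) := by
  ext t
  simp only [Set.mem_image, Set.mem_Ioo]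
  constructor
  · rintro ⟨θ, ⟨h0, h1⟩, rfl⟩
    have hl : Real.cos θ < 1 := by
      simpa using Real.cos_lt_cos_of_nonneg_of_le_pi le_rfl h1.le h0
    have hg : -1 < Real.cos θ := by
      simpa using Real.cos_lt_cos_of_nonneg_of_le_pi h0.le le_rfl h1
    constructor <;> nlinarith
  · rintro ⟨h0, h1⟩
    have h2 : -1 < t / (2 * s) := by rw [lt_div_iff₀ (by positivity)]; linarith
    have h3 : t / (2 * s) < 1 := by rw [div_lt_iff₀ (by positivity)]; linarith
    refine ⟨Real.arccos (t / (2 * s)), ⟨Real.arccos_pos.2 h3, Real.arccos_lt_pi.2 h2⟩, ?_⟩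
    rw [Real.cos_arccos h2.le h3.le]
    field_simp

theorem sqrt_sub_sq_cos {c : ℝ} (hc : 0 < c) {θ : ℝ} (hθ : θ ∈ Set.Ioo 0 Real.pi) :
    √(4 * c - (2 * √c * Real.cos θ) ^ 2) = 2 * √c * Real.sin θ := by
  have h := Real.sin_pos_of_mem_Ioo hθ
  rw [show 4 * c - (2 * √c * Real.cos θ) ^ 2 = (2 * √c * Real.sin θ) ^ 2 by
    rw [mul_pow, mul_pow, mul_pow, mul_pow, Real.sq_sqrt hc.le, Real.sin_sq]; ring]
  exact Real.sqrt_sq (by positivity)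

/-- The substitution `t = 2 √c cos θ` for integrals against the semicircle weight. -/
theorem semicircle_substitution {c : ℝ} (hc : 0 < c) (g : ℝ → ℂ) :
    (IntegrableOn (fun t => (√(4 * c - t ^ 2) : ℂ) * g t) (Set.Ioo (-(2 * √c)) (2 * √c)) ↔
      IntegrableOn (fun θ => 4 * c * ((Real.sin θ : ℂ) ^ 2 * g (2 * √c * Real.cos θ)))
        (Set.Ioo 0 Real.pi)) ∧
    ∫ t in Set.Ioo (-(2 * √c)) (2 * √c), (√(4 * c - t ^ 2) : ℂ) * g t =
      ∫ θ in Set.Ioo 0 Real.pi, 4 * c * ((Real.sin θ : ℂ) ^ 2 * g (2 * √c * Real.cos θ)) := by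
  have hs : 0 < √c := Real.sqrt_pos.2 hc
  have hd : ∀ θ ∈ Set.Ioo 0 Real.pi, HasDerivWithinAt (fun θ => 2 * √c * Real.cos θ)
      (2 * √c * -Real.sin θ) (Set.Ioo 0 Real.pi) θ := fun θ _ =>
    ((Real.hasDerivAt_cos θ).const_mul _).hasDerivWithinAt
  have hinj : Set.InjOn (fun θ => 2 * √c * Real.cos θ) (Set.Ioo 0 Real.pi) := by
    intro x hx y hy hxy
    exact Real.injOn_cos (Set.Ioo_subset_Icc_self hx) (Set.Ioo_subset_Icc_self hy)
      (mul_left_cancel₀ (by positivity) hxy)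
  have hfun : Set.EqOn (fun θ => |2 * √c * -Real.sin θ| •
      ((√(4 * c - (2 * √c * Real.cos θ) ^ 2) : ℂ) * g (2 * √c * Real.cos θ)))
      (fun θ => 4 * c * ((Real.sin θ : ℂ) ^ 2 * g (2 * √c * Real.cos θ)))
      (Set.Ioo 0 Real.pi) := by
    intro θ hθ
    have h := Real.sin_pos_of_mem_Ioo hθ
    have h2 : ((√c : ℝ) : ℂ) ^ 2 = c := by rw [← Complex.ofReal_pow, Real.sq_sqrt hc.le]
    simp only [sqrt_sub_sq_cos hc hθ]
    rw [mul_neg, abs_neg, abs_of_pos (by positivity), Complex.real_smul]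
    push_cast
    linear_combination 4 * Complex.sin θ ^ 2 * g (2 * √c * Real.cos θ) * h2
  rw [← image_cos_Ioo hs, integrableOn_image_iff_integrableOn_abs_deriv_smul measurableSet_Ioo hd
    hinj, integral_image_eq_integral_abs_deriv_smul measurableSet_Ioo hd hinj]
  exact ⟨integrableOn_congr_fun hfun measurableSet_Ioo,
    setIntegral_congr_fun measurableSet_Ioo hfun⟩

theorem sub_eq_of_root {c : ℝ} {w y : ℂ} (hy : y ≠ 0) (h : y ^ 2 + w * y + c = 0) (t : ℂ) :
    t - w = (y ^ 2 + t * y + c) / y := by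
  field_simp
  linear_combination -h

theorem denominator_rescale {c : ℝ} (hc : 0 < c) (y : ℂ) (θ : ℝ) :
    y ^ 2 + ((2 * √c * Real.cos θ : ℝ) : ℂ) * y + c =
      c * (1 + 2 * (y / √c) * Real.cos θ + (y / √c) ^ 2) := by
  have h2 : ((√c : ℝ) : ℂ) ^ 2 = c := by rw [← Complex.ofReal_pow, Real.sq_sqrt hc.le]
  have h0 : ((√c : ℝ) : ℂ) ≠ 0 := by
    simpa using (Real.sqrt_pos.2 hc).ne'
  rw [← h2]
  push_cast
  field_simp
  ring

theorem norm_div_sqrt_lt {c : ℝ} (hc : 0 < c) {y : ℂ} (hy : ‖y‖ < √c) : ‖y / √c‖ < 1 := by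
  have hs : 0 < √c := Real.sqrt_pos.2 hc
  rw [norm_div, Complex.norm_real, Real.norm_of_nonneg hs.le]
  exact (div_lt_one hs).2 hy

/-- This is the edge case of a pole at `±2√c`. Since `sin² θ = (1 - r cos θ) (1 + r cos θ)` when `r²
= 1`, the singular denominator `2 (1 + r cos θ)` cancels. -/
theorem integral_sin_sq_div_of_sq_eq_one {r : ℂ} (hr : r ^ 2 = 1) :
    IntegrableOn (fun θ : ℝ => (Real.sin θ : ℂ) ^ 2 / (1 + 2 * r * Real.cos θ + r ^ 2))
      (Set.Ioo 0 Real.pi) ∧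
    ∫ θ in Set.Ioo 0 Real.pi, (Real.sin θ : ℂ) ^ 2 / (1 + 2 * r * Real.cos θ + r ^ 2) =
      (Real.pi : ℂ) / 2 := by
  have hfun : Set.EqOn (fun θ : ℝ => (Real.sin θ : ℂ) ^ 2 / (1 + 2 * r * Real.cos θ + r ^ 2))
      (fun θ : ℝ => 1 / 2 - r / 2 * Complex.cos θ) (Set.Ioo 0 Real.pi) := by
    intro θ hθ
    have h := Real.sin_pos_of_mem_Ioo hθ
    have h1 : Complex.sin θ ≠ 0 := by
      rw [← Complex.ofReal_sin]; exact_mod_cast h.ne'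
    have h2 := Complex.sin_sq_add_cos_sq θ
    have h3 : 1 + 2 * r * Real.cos θ + r ^ 2 ≠ 0 := by
      intro h0
      rw [hr] at h0
      push_cast at h0
      have h4 : r * Complex.cos θ = -1 := by linear_combination h0 / 2
      have : Complex.sin θ ^ 2 = 0 := by
        linear_combination h2 - Complex.cos θ ^ 2 * hr.symm - (r * Complex.cos θ - 1) * h4
      exact h1 (by simpa using this)
    simp only
    rw [div_eq_iff h3, hr]
    push_cast
    linear_combination h2 + Complex.cos θ ^ 2 * hr
  have hcont : Continuous fun θ : ℝ => 1 / 2 - r / 2 * Complex.cos θ := by fun_prop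
  constructor
  · rw [integrableOn_congr_fun hfun measurableSet_Ioo]
    exact (hcont.integrableOn_Icc).mono_set Set.Ioo_subset_Icc_self
  · rw [setIntegral_congr_fun measurableSet_Ioo hfun, ← integral_Ioc_eq_integral_Ioo,
      ← intervalIntegral.integral_of_le Real.pi_pos.le, intervalIntegral.integral_sub
      (by simp) ((by fun_prop : Continuous fun θ : ℝ => r / 2 * Complex.cos θ).intervalIntegrable _ _),
      intervalIntegral.integral_const_mul]
    have : ∫ θ : ℝ in (0 : ℝ)..Real.pi, Complex.cos θ = 0 := by
      have := intervalIntegral.integral_ofReal (a := 0) (b := Real.pi) (f := Real.cos) (μ := volume)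
      simpa using this
    rw [this]
    simp
    ring

/-- The Stieltjes transform of the semicircle weight. -/
theorem semicircle_integral {c : ℝ} (hc : 0 < c) {w y : ℂ} (h : IsInnerRoot c w y) :
    IntegrableOn (fun t : ℝ => (√(4 * c - t ^ 2) : ℂ) * (1 / (t - w)))
      (Set.Ioo (-(2 * √c)) (2 * √c)) ∧
    ∫ t in Set.Ioo (-(2 * √c)) (2 * √c), (√(4 * c - t ^ 2) : ℂ) * (1 / (t - w)) =
      2 * Real.pi * y := by
  have hs : 0 < √c := Real.sqrt_pos.2 hc
  have hs0 : ((√c : ℝ) : ℂ) ≠ 0 := by simpa using hs.ne'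
  have hy := h.ne_zero hc
  have hc0 : (c : ℂ) ≠ 0 := by exact_mod_cast hc.ne'
  have hfun : (fun θ : ℝ => 4 * c * ((Real.sin θ : ℂ) ^ 2 *
      (1 / (((2 * √c * Real.cos θ : ℝ) : ℂ) - w)))) =
      fun θ : ℝ => 4 * y * ((Real.sin θ : ℂ) ^ 2 /
        (1 + 2 * (y / √c) * Real.cos θ + (y / √c) ^ 2)) := by
    funext θ
    rw [sub_eq_of_root hy h.1, denominator_rescale hc]
    generalize 1 + 2 * (y / √c) * Real.cos θ + (y / √c) ^ 2 = D
    rw [one_div_div]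
    field_simp
  have hr : IntegrableOn (fun θ : ℝ => (Real.sin θ : ℂ) ^ 2 /
        (1 + 2 * (y / √c) * Real.cos θ + (y / √c) ^ 2)) (Set.Ioo 0 Real.pi) ∧
    ∫ θ in Set.Ioo 0 Real.pi, (Real.sin θ : ℂ) ^ 2 /
        (1 + 2 * (y / √c) * Real.cos θ + (y / √c) ^ 2) = (Real.pi : ℂ) / 2 := by
    rcases h.2 with h2 | h2
    · have hn := norm_div_sqrt_lt hc h2
      constructor
      · refine (Continuous.integrableOn_Icc ?_).mono_set Set.Ioo_subset_Icc_self
        exact Continuous.div (by fun_prop) (by fun_prop) (one_add_mul_cos_add_sq_ne_zero hn)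
      · rw [← integral_Ioc_eq_integral_Ioo, ← intervalIntegral.integral_of_le Real.pi_pos.le]
        exact integral_sin_sq_div_of_norm_lt hn (div_ne_zero hy hs0)
    · apply integral_sin_sq_div_of_sq_eq_one
      rw [div_pow, h2, ← Complex.ofReal_pow, Real.sq_sqrt hc.le, div_self hc0]
  obtain ⟨h1, h2⟩ := semicircle_substitution hc fun t : ℝ => 1 / ((t : ℂ) - w)
  rw [h1, h2, hfun]
  refine ⟨hr.1.const_mul _, ?_⟩
  rw [integral_const_mul, hr.2]
  ring

theorem semicircle_integral_sq {c : ℝ} (hc : 0 < c) {w y : ℂ} (h : y ^ 2 + w * y + c = 0)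
    (hlt : ‖y‖ < √c) :
    IntegrableOn (fun t : ℝ => (√(4 * c - t ^ 2) : ℂ) * (1 / ((t - w) * (t - w))))
      (Set.Ioo (-(2 * √c)) (2 * √c)) ∧
    ∫ t in Set.Ioo (-(2 * √c)) (2 * √c), (√(4 * c - t ^ 2) : ℂ) * (1 / ((t - w) * (t - w))) =
      2 * Real.pi * (y * y) / (c - y * y) := by
  have hs : 0 < √c := Real.sqrt_pos.2 hc
  have hs0 : ((√c : ℝ) : ℂ) ≠ 0 := by simpa using hs.ne'
  have hy := IsInnerRoot.ne_zero ⟨h, Or.inl hlt⟩ hc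
  have hc0 : (c : ℂ) ≠ 0 := by exact_mod_cast hc.ne'
  have hs2 : ((√c : ℝ) : ℂ) ^ 2 = c := by rw [← Complex.ofReal_pow, Real.sq_sqrt hc.le]
  have hn := norm_div_sqrt_lt hc hlt
  have hfun : (fun θ : ℝ => 4 * c * ((Real.sin θ : ℂ) ^ 2 *
      (1 / ((((2 * √c * Real.cos θ : ℝ) : ℂ) - w) * (((2 * √c * Real.cos θ : ℝ) : ℂ) - w))))) =
      fun θ : ℝ => 4 * y ^ 2 / c * ((Real.sin θ : ℂ) ^ 2 /
        (1 + 2 * (y / √c) * Real.cos θ + (y / √c) ^ 2) ^ 2) := by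
    funext θ
    rw [sub_eq_of_root hy h, denominator_rescale hc]
    have hD := one_add_mul_cos_add_sq_ne_zero hn θ
    generalize 1 + 2 * (y / √c) * Real.cos θ + (y / √c) ^ 2 = D at *
    field_simp
  obtain ⟨h1, h2⟩ := semicircle_substitution hc fun t : ℝ => 1 / (((t : ℂ) - w) * ((t : ℂ) - w))
  rw [h1, h2, hfun]
  constructor
  · refine Integrable.const_mul ?_ _
    refine (Continuous.integrableOn_Icc ?_).mono_set Set.Ioo_subset_Icc_self
    exact Continuous.div (by fun_prop) (by fun_prop)
      fun θ => pow_ne_zero 2 (one_add_mul_cos_add_sq_ne_zero hn θ)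
  · rw [integral_const_mul, ← integral_Ioc_eq_integral_Ioo,
      ← intervalIntegral.integral_of_le Real.pi_pos.le,
      integral_sin_sq_div_sq hn (div_ne_zero hy hs0), div_pow, hs2]
    field_simp
    norm_num

theorem IsInnerRoot.norm_sq_le {c : ℝ} (hc : 0 < c) {w y : ℂ} (h : IsInnerRoot c w y) :
    ‖y‖ ^ 2 ≤ c := by
  rcases h.2 with h | h
  · exact (Real.lt_sqrt (norm_nonneg y)).1 h |>.le
  · rw [← norm_pow, h, Complex.norm_real, Real.norm_of_nonneg hc.le]

/-- Two inner roots have product `c` only if they are the same double root. -/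
theorem IsInnerRoot.eq_of_mul_eq {c : ℝ} (hc : 0 < c) {a b y₁ y₂ : ℂ} (h₁ : IsInnerRoot c a y₁)
    (h₂ : IsInnerRoot c b y₂) (h : y₁ * y₂ = c) : y₁ = y₂ ∧ y₁ ^ 2 = c := by
  have hn : ‖y₁‖ * ‖y₂‖ = c := by
    rw [← norm_mul, h, Complex.norm_real, Real.norm_of_nonneg hc.le]
  have l₁ := h₁.norm_sq_le hc
  have l₂ := h₂.norm_sq_le hc
  have hlt : ¬ ‖y₁‖ < √c := by
    intro hlt
    have := (Real.lt_sqrt (norm_nonneg y₁)).1 hlt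
    nlinarith [sq_nonneg (‖y₁‖ - ‖y₂‖)]
  have h1 : y₁ ^ 2 = c := h₁.2.resolve_left hlt
  refine ⟨?_, h1⟩
  have : y₁ * (y₁ - y₂) = 0 := by linear_combination h1 - h
  rcases mul_eq_zero.1 this with h0 | h0
  · exact absurd h0 (h₁.ne_zero hc)
  · exact sub_eq_zero.1 h0

/-- As `a = -(y₁ + c / y₁)`, differences of poles become differences of roots. This identity
simplifies every partial fraction below. -/
theorem sub_mul_eq {c : ℝ} {a b y₁ y₂ : ℂ} (h₁ : y₁ ^ 2 + a * y₁ + c = 0)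
    (h₂ : y₂ ^ 2 + b * y₂ + c = 0) :
    (a - b) * (y₁ * y₂) = (y₁ - y₂) * (c - y₁ * y₂) := by
  linear_combination y₂ * h₁ - y₁ * h₂

theorem IsInnerRoot.unique {c : ℝ} (hc : 0 < c) {a y₁ y₂ : ℂ} (h₁ : IsInnerRoot c a y₁)
    (h₂ : IsInnerRoot c a y₂) : y₁ = y₂ := by
  have h := sub_mul_eq h₁.1 h₂.1
  rw [sub_self, zero_mul, eq_comm, mul_eq_zero] at h
  rcases h with h | h
  · exact sub_eq_zero.1 h
  · exact (h₁.eq_of_mul_eq hc h₂ (by linear_combination -h)).1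

theorem IsInnerRoot.sub_mul_ne_zero {c : ℝ} (hc : 0 < c) {a b y₁ y₂ : ℂ}
    (h₁ : IsInnerRoot c a y₁) (h₂ : IsInnerRoot c b y₂) (hab : ¬ (a = b ∧ y₁ ^ 2 = c)) :
    (c : ℂ) - y₁ * y₂ ≠ 0 := by
  intro h
  obtain ⟨h3, h4⟩ := h₁.eq_of_mul_eq hc h₂ (by linear_combination -h)
  subst h3
  refine hab ⟨?_, h4⟩
  have := sub_mul_eq h₁.1 h₂.1
  rw [sub_self, zero_mul, mul_eq_zero, sub_eq_zero] at this
  exact this.resolve_right (mul_ne_zero (h₁.ne_zero hc) (h₁.ne_zero hc))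

/-- For `a ≠ b`, partial fractions give `(y₁ - y₂) / (a - b)`, which `sub_mul_eq` rewrites in a form
that stays regular at `a = b` and agrees there with the double pole. The excluded case is a double
pole at an edge. -/
theorem semicircle_integral_pair {c : ℝ} (hc : 0 < c) {a b y₁ y₂ : ℂ} (h₁ : IsInnerRoot c a y₁)
    (h₂ : IsInnerRoot c b y₂) (hab : ¬ (a = b ∧ y₁ ^ 2 = c))
    (ha : ∀ t ∈ Set.Ioo (-(2 * √c)) (2 * √c), (t : ℂ) - a ≠ 0)
    (hb : ∀ t ∈ Set.Ioo (-(2 * √c)) (2 * √c), (t : ℂ) - b ≠ 0) :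
    IntegrableOn (fun t : ℝ => (√(4 * c - t ^ 2) : ℂ) * (1 / ((t - a) * (t - b))))
      (Set.Ioo (-(2 * √c)) (2 * √c)) ∧
    ∫ t in Set.Ioo (-(2 * √c)) (2 * √c), (√(4 * c - t ^ 2) : ℂ) * (1 / ((t - a) * (t - b))) =
      2 * Real.pi * (y₁ * y₂) / (c - y₁ * y₂) := by
  by_cases h : a = b
  · subst h
    obtain rfl := h₁.unique hc h₂
    exact semicircle_integral_sq hc h₁.1 (h₁.2.resolve_right fun h => hab ⟨rfl, h⟩)
  · have hne : a - b ≠ 0 := sub_ne_zero.2 h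
    have hfun : Set.EqOn (fun t : ℝ => (√(4 * c - t ^ 2) : ℂ) * (1 / ((t - a) * (t - b))))
        (fun t : ℝ => (a - b)⁻¹ * ((√(4 * c - t ^ 2) : ℂ) * (1 / (t - a)) -
          (√(4 * c - t ^ 2) : ℂ) * (1 / (t - b)))) (Set.Ioo (-(2 * √c)) (2 * √c)) := by
      intro t ht
      have h1 := ha t ht
      have h2 := hb t ht
      simp only
      field_simp
      ring
    obtain ⟨i₁, v₁⟩ := semicircle_integral hc h₁
    obtain ⟨i₂, v₂⟩ := semicircle_integral hc h₂
    rw [integrableOn_congr_fun hfun measurableSet_Ioo,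
      setIntegral_congr_fun measurableSet_Ioo hfun]
    refine ⟨(i₁.sub i₂).const_mul _, ?_⟩
    rw [integral_const_mul, integral_sub i₁ i₂, v₁, v₂]
    have := h₁.sub_mul_ne_zero hc h₂ hab
    have key := sub_mul_eq h₁.1 h₂.1
    field_simp
    linear_combination -key

/-- The integral of the semicircle weight against `1 / ((t - a) (t - b) (t - w))`. -/
theorem semicircle_integral_triple {c : ℝ} (hc : 0 < c) {a b w y₁ y₂ y : ℂ}
    (h₁ : IsInnerRoot c a y₁) (h₂ : IsInnerRoot c b y₂) (h : IsInnerRoot c w y)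
    (hab : ¬ (a = b ∧ y₁ ^ 2 = c)) (hlt : ‖y‖ < √c) (hwb : w ≠ b)
    (ha : ∀ t ∈ Set.Ioo (-(2 * √c)) (2 * √c), (t : ℂ) - a ≠ 0)
    (hb : ∀ t ∈ Set.Ioo (-(2 * √c)) (2 * √c), (t : ℂ) - b ≠ 0)
    (hw : ∀ t ∈ Set.Ioo (-(2 * √c)) (2 * √c), (t : ℂ) - w ≠ 0) :
    ∫ t in Set.Ioo (-(2 * √c)) (2 * √c),
      (√(4 * c - t ^ 2) : ℂ) * (1 / ((t - a) * (t - b))) * (1 / (t - w)) =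
      2 * Real.pi * (y₁ * y₂) / (c - y₁ * y₂) * (c * y / ((c - y * y₁) * (c - y * y₂))) := by
  have hy2 : y ^ 2 ≠ c := by
    intro h0
    have : ‖y‖ ^ 2 = c := by
      rw [← norm_pow, h0, Complex.norm_real, Real.norm_of_nonneg hc.le]
    have := (Real.lt_sqrt (norm_nonneg y)).1 hlt
    linarith
  have hne : w - b ≠ 0 := sub_ne_zero.2 hwb
  -- Only the factor `w - b` is divided out, so `a = b` and `w = a` remain allowed.
  have hfun : Set.EqOn
      (fun t : ℝ => (√(4 * c - t ^ 2) : ℂ) * (1 / ((t - a) * (t - b))) * (1 / (t - w)))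
      (fun t : ℝ => (w - b)⁻¹ * ((√(4 * c - t ^ 2) : ℂ) * (1 / ((t - w) * (t - a))) -
        (√(4 * c - t ^ 2) : ℂ) * (1 / ((t - a) * (t - b))))) (Set.Ioo (-(2 * √c)) (2 * √c)) := by
    intro t ht
    have e1 := ha t ht
    have e2 := hb t ht
    have e3 := hw t ht
    simp only
    field_simp
    ring
  obtain ⟨i₁, v₁⟩ := semicircle_integral_pair hc h h₁ (fun h => hy2 h.2) hw ha
  obtain ⟨i₂, v₂⟩ := semicircle_integral_pair hc h₁ h₂ hab ha hb
  rw [setIntegral_congr_fun measurableSet_Ioo hfun, integral_const_mul, integral_sub i₁ i₂, v₁, v₂]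
  have n1 := h₁.sub_mul_ne_zero hc h₂ hab
  have n2 := h.sub_mul_ne_zero hc h₁ (fun h => hy2 h.2)
  have n3 := h.sub_mul_ne_zero hc h₂ (fun h => hy2 h.2)
  have key := sub_mul_eq h.1 h₂.1
  rw [inv_mul_eq_iff_eq_mul₀ hne, div_sub_div _ _ n2 n1, div_mul_div_comm, mul_div_assoc',
    div_eq_div_iff (mul_ne_zero n2 n1) (mul_ne_zero n1 (mul_ne_zero n2 n3))]
  linear_combination (-2 * Real.pi * c * y₁ * (c - y * y₁) * (c - y₁ * y₂)) * key

/-! ### The branch `ρ` lies in the disc -/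

/-- For non-real `w`, `ρ(w)` is the root of `z² + w z + c` inside the disc of radius `√c`. -/
theorem rho_spec {c : ℝ} (hc : 0 < c) {w : ℂ} (hw : w.im ≠ 0) :
    rho c w ^ 2 + w * rho c w + c = 0 ∧ ‖rho c w‖ < √c := by
  have hsq := semiSqrt_sq c hc.le w
  have hroot : rho c w ^ 2 + w * rho c w + c = 0 := by
    rw [rho]; linear_combination hsq / 4
  refine ⟨hroot, ?_⟩
  set p : ℂ := (w - 2 * (√c : ℝ)) ^ (1 / 2 : ℂ) with hp
  set q : ℂ := (w + 2 * (√c : ℝ)) ^ (1 / 2 : ℂ) with hq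
  have hp2 : p ^ 2 = w - 2 * (√c : ℝ) := by simp [hp]
  have hq2 : q ^ 2 = w + 2 * (√c : ℝ) := by simp [hq]
  have hre : ∀ z : ℂ, 0 ≤ (z ^ (1 / 2 : ℂ)).re := by
    intro z
    rcases eq_or_ne z 0 with rfl | hz
    · simp
    · rw [Complex.cpow_def_of_ne_zero hz, Complex.exp_re]
      refine mul_nonneg (Real.exp_pos _).le (Real.cos_nonneg_of_mem_Icc ?_)
      have him : (Complex.log z * (1 / 2)).im = z.arg / 2 := by
        rw [Complex.mul_im, Complex.log_im]
        norm_num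
        ring
      rw [him]
      have h1 := Complex.neg_pi_lt_arg z
      have h2 := Complex.arg_le_pi z
      constructor <;> linarith
  have hsign : ∀ z x : ℂ, z ^ 2 = x → 2 * (z.re * z.im) = x.im := by
    rintro z x rfl
    simp [pow_two]; ring
  have p1 := hsign p _ hp2
  have q1 := hsign q _ hq2
  have p0 := hre (w - 2 * (√c : ℝ))
  have q0 := hre (w + 2 * (√c : ℝ))
  rw [← hp] at p0
  rw [← hq] at q0
  simp at p1 q1
  -- Both roots have positive real part, and `w ± 2√c` share their imaginary part, so `p.im` and
  -- `q.im` have the same sign. Hence `p` is closer to `q` than to `-q`.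
  have hprod : 0 < p.re * q.re + p.im * q.im := by
    have hp' : 0 < p.re := lt_of_le_of_ne p0 (by rintro h; rw [← h] at p1; simp at p1; exact hw p1.symm)
    have hq' : 0 < q.re := lt_of_le_of_ne q0 (by rintro h; rw [← h] at q1; simp at q1; exact hw q1.symm)
    have h1 : 0 < (p.re * q.re) * (p.im * q.im) := by
      have : (p.re * q.re) * (p.im * q.im) = (w.im / 2) ^ 2 := by
        rw [show w.im = 2 * (p.re * p.im) from p1.symm]
        linear_combination (p.re * p.im) / 2 * (q1 - p1)
      rw [this]; positivity
    have h2 : 0 < p.re * q.re := mul_pos hp' hq'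
    have := (mul_pos_iff_of_pos_left h2).1 h1
    linarith
  have hs : 0 < √c := Real.sqrt_pos.2 hc
  -- With `‖p - q‖ * ‖p + q‖ = 4√c` and `‖p - q‖ < ‖p + q‖` this yields `‖ρ‖ < √c`.
  have hrho : rho c w = -((p - q) ^ 2 / 4) := by
    rw [rho, semiSqrt, ← hp, ← hq]
    linear_combination (1 / 4 : ℂ) * (hp2 + hq2)
  have hmul : ‖p - q‖ * ‖p + q‖ = 4 * √c := by
    have : (p - q) * (p + q) = ((-(4 * √c) : ℝ) : ℂ) := by
      push_cast
      linear_combination hp2 - hq2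
    rw [← norm_mul, this, Complex.norm_real, norm_neg, Real.norm_of_nonneg (by positivity)]
  have hlt : ‖p - q‖ < ‖p + q‖ := by
    refine lt_of_pow_lt_pow_left₀ 2 (norm_nonneg _) ?_
    rw [← Complex.normSq_eq_norm_sq, ← Complex.normSq_eq_norm_sq, Complex.normSq_apply,
      Complex.normSq_apply]
    simp only [Complex.sub_re, Complex.sub_im, Complex.add_re, Complex.add_im]
    linarith
  have hpos : 0 < ‖p - q‖ := by
    refine lt_of_le_of_ne (norm_nonneg _) fun h => ?_
    rw [← h, zero_mul] at hmul
    linarith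
  rw [hrho, norm_neg, norm_div, norm_pow, Complex.norm_ofNat]
  nlinarith

/-! ### The normalized measure and its Stieltjes transform -/

theorem ofReal_quad {a b : ℂ} (hsum : (a + b).im = 0) (hprod : (a * b).im = 0) (N t : ℝ) :
    (quad N a b t : ℂ) = N * (((t : ℂ) - a) * ((t : ℂ) - b)) := by
  have him : (((t : ℂ) - a) * ((t : ℂ) - b)).im = 0 := by
    simp only [Complex.add_im, Complex.mul_im, Complex.sub_re, Complex.sub_im, Complex.ofReal_re,
      Complex.ofReal_im] at *
    linear_combination hprod - t * hsum
  rw [quad, Complex.ofReal_mul]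
  congr 1
  exact Complex.ext (by simp) (by rw [him, Complex.ofReal_im])

theorem sub_ne_zero_of_quad_pos {N : ℝ} {a b : ℂ} {t : ℝ} (h : 0 < quad N a b t) :
    (t : ℂ) - a ≠ 0 ∧ (t : ℂ) - b ≠ 0 := by
  constructor <;> intro h0 <;> rw [quad, h0] at h <;> simp at h

theorem measurable_density (c N : ℝ) (a b : ℂ) :
    Measurable fun t : ℝ => √(4 * c - t ^ 2) / quad N a b t := by
  unfold quad
  fun_prop

theorem ofReal_sub_ne_zero_of_im_ne_zero {w : ℂ} (hw : w.im ≠ 0) (t : ℝ) : (t : ℂ) - w ≠ 0 := by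
  intro h
  apply hw
  rw [← sub_eq_zero.1 h, Complex.ofReal_im]

/-- The density of `quadMeasure` is integrable with positive integral, and its Stieltjes transform
is explicit in terms of inner roots. -/
theorem quadMeasure_spec {c : ℝ} (hc : 0 < c) {a b y₁ y₂ : ℂ} (hsum : (a + b).im = 0)
    (hprod : (a * b).im = 0) {N : ℝ}
    (hQ : ∀ t ∈ Set.Ioo (-(2 * √c)) (2 * √c), 0 < quad N a b t)
    (h₁ : IsInnerRoot c a y₁) (h₂ : IsInnerRoot c b y₂) (hab : ¬ (a = b ∧ y₁ ^ 2 = c)) :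
    IsProbabilityMeasure (quadMeasure c N a b) ∧
    ∀ w : ℂ, w.im ≠ 0 → stieltjes (quadMeasure c N a b) w =
      c * rho c w / ((c - rho c w * y₁) * (c - rho c w * y₂)) := by
  have hs : 0 < √c := Real.sqrt_pos.2 hc
  set I := Set.Ioo (-(2 * √c)) (2 * √c) with hI
  set f : ℝ → ℝ := fun t => √(4 * c - t ^ 2) / quad N a b t with hf
  have ha : ∀ t ∈ I, (t : ℂ) - a ≠ 0 := fun t ht => (sub_ne_zero_of_quad_pos (hQ t ht)).1
  have hb : ∀ t ∈ I, (t : ℂ) - b ≠ 0 := fun t ht => (sub_ne_zero_of_quad_pos (hQ t ht)).2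
  have hN : (N : ℂ) ≠ 0 := by
    have := hQ 0 ⟨by linarith, by linarith⟩
    intro h0
    rw [quad, Complex.ofReal_eq_zero.1 h0] at this
    simp at this
  have hfC : ∀ t : ℝ, (f t : ℂ) =
      (N : ℂ)⁻¹ * ((√(4 * c - t ^ 2) : ℂ) * (1 / ((t - a) * (t - b)))) := by
    intro t
    rw [hf, Complex.ofReal_div, ofReal_quad hsum hprod, div_eq_mul_inv, mul_inv, one_div]
    ring
  obtain ⟨i, v⟩ := semicircle_integral_pair hc h₁ h₂ hab ha hb
  have hfint : Integrable f (volume.restrict I) := by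
    have : Integrable (fun t => (f t : ℂ)) (volume.restrict I) := by
      simp_rw [hfC]
      exact i.const_mul _
    exact this.re
  have hfnn : 0 ≤ᵐ[volume.restrict I] f :=
    (ae_restrict_mem measurableSet_Ioo).mono fun t ht => div_nonneg (Real.sqrt_nonneg _) (hQ t ht).le
  set m : ℝ := ∫ t in I, f t with hm
  have hmC : (m : ℂ) = (N : ℂ)⁻¹ * (2 * Real.pi * (y₁ * y₂) / (c - y₁ * y₂)) := by
    rw [hm, ← integral_complex_ofReal]
    simp_rw [hfC]
    rw [integral_const_mul, v]
  have hne := h₁.sub_mul_ne_zero hc h₂ hab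
  have hm0 : (m : ℂ) ≠ 0 := by
    rw [hmC]
    have hpi : (Real.pi : ℂ) ≠ 0 := by exact_mod_cast Real.pi_ne_zero
    exact mul_ne_zero (inv_ne_zero hN) (div_ne_zero (mul_ne_zero (mul_ne_zero two_ne_zero hpi)
      (mul_ne_zero (h₁.ne_zero hc) (h₂.ne_zero hc))) hne)
  -- Positivity of the mass needs no estimate: the integral is nonnegative, and its closed form does
  -- not vanish.
  have hmpos : 0 < m := lt_of_le_of_ne (integral_nonneg_of_ae hfnn) fun h => hm0 (by simp [← h])
  have hraw : rawMeasure c N a b Set.univ = ENNReal.ofReal m := by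
    rw [rawMeasure, withDensity_apply _ MeasurableSet.univ, Measure.restrict_univ, hm,
      ofReal_integral_eq_lintegral_ofReal hfint hfnn]
  have hpos : ENNReal.ofReal m ≠ 0 := by simpa using hmpos
  refine ⟨⟨?_⟩, fun w hw => ?_⟩
  · rw [quadMeasure, Measure.smul_apply, hraw, smul_eq_mul,
      ENNReal.inv_mul_cancel hpos ENNReal.ofReal_ne_top]
  · have hwt : ∀ t ∈ I, (t : ℂ) - w ≠ 0 := fun t _ => ofReal_sub_ne_zero_of_im_ne_zero hw t
    obtain ⟨hr, hlt⟩ := rho_spec hc hw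
    have htriple : ∫ t in I, (√(4 * c - t ^ 2) : ℂ) * (1 / ((t - a) * (t - b))) * (1 / (t - w)) =
        2 * Real.pi * (y₁ * y₂) / (c - y₁ * y₂) *
          (c * rho c w / ((c - rho c w * y₁) * (c - rho c w * y₂))) := by
      -- A non-real `b` can equal `w`. Then `a ≠ w`, because `a + b` is real, and the roles of `a`
      -- and `b` are exchanged.
      by_cases hwb : w = b
      · have hwa : w ≠ a := by
          rintro rfl
          subst hwb
          apply hw
          rw [Complex.add_im] at hsum
          linarith
        have hab' : ¬ (b = a ∧ y₂ ^ 2 = c) := by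
          rintro ⟨rfl, h⟩
          exact hwa hwb
        have := semicircle_integral_triple hc h₂ h₁ ⟨hr, Or.inl hlt⟩ hab' hlt hwa hb ha hwt
        rw [mul_comm y₁ y₂, mul_comm ((c : ℂ) - rho c w * y₁), ← this]
        simp_rw [mul_comm ((_ : ℂ) - a)]
        rfl
      · exact semicircle_integral_triple hc h₁ h₂ ⟨hr, Or.inl hlt⟩ hab hlt hwb ha hb hwt
    rw [stieltjes_eq, quadMeasure, integral_smul_measure, hraw, rawMeasure,
      integral_withDensity_eq_integral_toReal_smul
        (measurable_density c N a b).ennreal_ofReal (by simp)]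
    have hfun : Set.EqOn (fun t : ℝ => (ENNReal.ofReal (√(4 * c - t ^ 2) / quad N a b t)).toReal •
        (1 / ((t : ℂ) - w))) (fun t : ℝ => (N : ℂ)⁻¹ *
          ((√(4 * c - t ^ 2) : ℂ) * (1 / ((t - a) * (t - b))) * (1 / (t - w)))) I := by
      intro t ht
      simp only
      rw [ENNReal.toReal_ofReal (div_nonneg (Real.sqrt_nonneg _) (hQ t ht).le), Complex.real_smul]
      rw [show ((√(4 * c - t ^ 2) / quad N a b t : ℝ) : ℂ) = (f t : ℂ) from rfl, hfC, mul_assoc]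
    rw [setIntegral_congr_fun measurableSet_Ioo hfun, integral_const_mul, htriple,
      ENNReal.toReal_inv, ENNReal.toReal_ofReal hmpos.le, Complex.real_smul, ← mul_assoc (N : ℂ)⁻¹,
      ← hmC, Complex.ofReal_inv, inv_mul_cancel_left₀ hm0]

theorem integrable_resolvent (μ : Measure ℝ) [IsFiniteMeasure μ] {w : ℂ} (hw : w.im ≠ 0) :
    Integrable (fun t : ℝ => 1 / ((t : ℂ) - w)) μ := by
  refine Integrable.of_bound (C := |w.im|⁻¹) (Measurable.aestronglyMeasurable (by fun_prop)) ?_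
  filter_upwards with t
  rw [norm_div, norm_one, one_div]
  refine inv_anti₀ (abs_pos.2 hw) ?_
  have := Complex.abs_im_le_norm ((t : ℂ) - w)
  simpa using this

theorem stieltjes_add_atoms (μ : Measure ℝ) [IsFiniteMeasure μ] (κ u v : ℝ≥0) (x x' : ℝ) {w : ℂ}
    (hw : w.im ≠ 0) :
    stieltjes (κ • μ + u • Measure.dirac x + v • Measure.dirac x') w =
      κ * stieltjes μ w + u * (1 / (x - w)) + v * (1 / (x' - w)) := by
  simp only [stieltjes_eq]
  rw [integral_add_measure (integrable_resolvent _ hw) (integrable_resolvent _ hw),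
    integral_add_measure (integrable_resolvent _ hw) (integrable_resolvent _ hw)]
  simp only [integral_smul_nnreal_measure, integral_dirac, NNReal.smul_def, Complex.real_smul]

theorem isProbabilityMeasure_add_atoms (μ : Measure ℝ) [IsProbabilityMeasure μ] {κ u v : ℝ≥0}
    (x x' : ℝ) (h : κ + u + v = 1) :
    IsProbabilityMeasure (κ • μ + u • Measure.dirac x + v • Measure.dirac x') := by
  constructor
  simp only [Measure.add_apply, Measure.smul_apply, measure_univ, ENNReal.smul_def, smul_eq_mul,
    mul_one]
  exact_mod_cast h

/-! ### Factor roots of a pair `(α, β)` -/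

/-- The pair `p = (α, β)` has factor roots `Y₁, Y₂`: in the variable `y = ρ(w)`, the denominator
`α - w - 2 β y` is `(c - y Y₁) (c - y Y₂) / (c y)`. -/
def HasFactorRoots (c : ℝ) (p : ℝ × ℝ) (Y₁ Y₂ : ℂ) : Prop :=
  (p.1 : ℂ) = -(Y₁ + Y₂) ∧ Y₁ * Y₂ = (1 - 2 * p.2) * c

theorem HasFactorRoots.symm {c : ℝ} {p : ℝ × ℝ} {Y₁ Y₂ : ℂ} (h : HasFactorRoots c p Y₁ Y₂) :
    HasFactorRoots c p Y₂ Y₁ :=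
  ⟨by rw [h.1, add_comm], by rw [mul_comm, h.2]⟩

theorem HasFactorRoots.unique {c : ℝ} (hc : 0 < c) {p q : ℝ × ℝ} {Y₁ Y₂ : ℂ}
    (hp : HasFactorRoots c p Y₁ Y₂) (hq : HasFactorRoots c q Y₁ Y₂) : p = q := by
  have hc0 : (c : ℂ) ≠ 0 := by exact_mod_cast hc.ne'
  have h1 : (p.1 : ℂ) = q.1 := by rw [hp.1, hq.1]
  have h2 : (p.2 : ℂ) = q.2 := by
    have h : (2 * c : ℂ) * (p.2 - q.2) = 0 := by linear_combination hp.2 - hq.2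
    rcases mul_eq_zero.1 h with h | h
    · simp [hc0] at h
    · exact sub_eq_zero.1 h
  exact Prod.ext (by exact_mod_cast h1) (by exact_mod_cast h2)

/-- Inner and outer roots are treated alike. The right-hand side has the form found in
`quadMeasure_spec`, so comparing transforms reduces to comparing factor roots. -/
theorem HasFactorRoots.oneShift_eq {c : ℝ} (hc : 0 < c) {p : ℝ × ℝ} {Y₁ Y₂ : ℂ}
    (h : HasFactorRoots c p Y₁ Y₂) {w : ℂ} (hw : w.im ≠ 0) :
    oneShift c p.1 p.2 w = c * rho c w / ((c - rho c w * Y₁) * (c - rho c w * Y₂)) := by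
  obtain ⟨hr, hlt⟩ := rho_spec hc hw
  have hy := IsInnerRoot.ne_zero ⟨hr, Or.inl hlt⟩ hc
  have hc0 : (c : ℂ) ≠ 0 := by exact_mod_cast hc.ne'
  rw [oneShift, shift]
  set y := rho c w
  have : (p.1 : ℂ) - w - p.2 * (2 * y) = (c - y * Y₁) * (c - y * Y₂) / (c * y) := by
    rw [eq_div_iff (mul_ne_zero hc0 hy)]
    linear_combination (c * y) * h.1 - c * hr - y ^ 2 * h.2
  rw [this, one_div_div]

/-- Behind the coefficient check: `G₀` is the product of `α - w - 2 β y` over both roots `y` of `z²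
+ w z + c`, and the product of `c - y Y₁` over them is `c (Y₁² + w Y₁ + c) = c Y₁ (w - a)`. -/
theorem HasFactorRoots.denom_eq {c : ℝ} {p : ℝ × ℝ} {Y₁ Y₂ : ℂ}
    (h : HasFactorRoots c p Y₁ Y₂) {a b : ℂ} (h₁ : Y₁ ^ 2 + a * Y₁ + c = 0)
    (h₂ : Y₂ ^ 2 + b * Y₂ + c = 0) (hc : 0 < c) (hY : Y₁ * Y₂ ≠ 0) :
    denom c p.1 p.2 = C (1 - 2 * (p.2 : ℂ)) * ((X - C a) * (X - C b)) := by
  have hc0 : (c : ℂ) ≠ 0 := by exact_mod_cast hc.ne'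
  have hk : (1 : ℂ) - 2 * p.2 = Y₁ * Y₂ / c := by rw [eq_div_iff hc0, h.2]
  have hβ : (p.2 : ℂ) = (1 - Y₁ * Y₂ / c) / 2 := by linear_combination -hk / 2
  have hY1 := left_ne_zero_of_mul hY
  have hY2 := right_ne_zero_of_mul hY
  have ha : a = -(Y₁ ^ 2 + c) / Y₁ := by rw [eq_div_iff hY1]; linear_combination h₁
  have hb : b = -(Y₂ ^ 2 + c) / Y₂ := by rw [eq_div_iff hY2]; linear_combination h₂
  have e1 : (p.1 : ℂ) ^ 2 + 4 * c * (p.2 : ℂ) ^ 2 = (1 - 2 * p.2) * (a * b) := by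
    rw [hk, hβ, h.1, ha, hb]; field_simp; ring
  have e2 : 2 * (p.1 : ℂ) * (1 - p.2) = (1 - 2 * p.2) * (a + b) := by
    rw [hk, hβ, h.1, ha, hb]; field_simp; ring
  rw [denom, e1, e2]
  simp only [C_mul, C_add]
  ring

theorem exists_factorRoots (c : ℝ) (p : ℝ × ℝ) : ∃ Y₁ Y₂ : ℂ, HasFactorRoots c p Y₁ Y₂ := by
  obtain ⟨s, hs⟩ := IsAlgClosed.exists_pow_nat_eq ((p.1 : ℂ) ^ 2 - 4 * ((1 - 2 * p.2) * c))
    (n := 2) (by norm_num)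
  exact ⟨(-p.1 + s) / 2, (-p.1 - s) / 2, by ring, by linear_combination -hs / 4⟩

theorem exists_of_root_ne_zero {c : ℝ} {Y : ℂ} (hY : Y ≠ 0) : ∃ a : ℂ, Y ^ 2 + a * Y + c = 0 :=
  ⟨-(Y ^ 2 + c) / Y, by field_simp; ring⟩

/-- A positive solution arises from a root of `z² + a z + c` and a root of `z² + b z + c`. -/
theorem isPositiveSolution_iff {c : ℝ} (hc : 0 < c) {a b : ℂ} {p : ℝ × ℝ} :
    IsPositiveSolution c a b p ↔ 0 < p.2 ∧ ∃ Y₁ Y₂ : ℂ, HasFactorRoots c p Y₁ Y₂ ∧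
      Y₁ ^ 2 + a * Y₁ + c = 0 ∧ Y₂ ^ 2 + b * Y₂ + c = 0 := by
  have hc0 : (c : ℂ) ≠ 0 := by exact_mod_cast hc.ne'
  refine and_congr_right fun _ => ⟨?_, ?_⟩
  · rintro ⟨k, hk, hden⟩
    obtain ⟨Y₁, Y₂, h⟩ := exists_factorRoots c p
    have hlead : (1 : ℂ) - 2 * p.2 = k := by
      have hco : ∀ u v k : ℂ, (C u - C v * X + C k * X ^ 2).coeff 2 = k := fun u v k => by simp
      have hq : C k * ((X - C a) * (X - C b)) =
          C (k * (a * b)) - C (k * (a + b)) * X + C k * X ^ 2 := by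
        simp only [C_mul, C_add]; ring
      have := congrArg (fun q : ℂ[X] => q.coeff 2) hden
      simpa only [hq, denom, hco] using this
    have hY : Y₁ * Y₂ ≠ 0 := by
      rw [h.2, hlead]; exact mul_ne_zero hk hc0
    obtain ⟨a', h₁⟩ := exists_of_root_ne_zero (c := c) (left_ne_zero_of_mul hY)
    obtain ⟨b', h₂⟩ := exists_of_root_ne_zero (c := c) (right_ne_zero_of_mul hY)
    have hden' := h.denom_eq h₁ h₂ hc hY
    rw [hden, hlead] at hden'
    have hpoly : (X - C a) * (X - C b) = (X - C a') * (X - C b') :=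
      mul_left_cancel₀ (C_ne_zero.2 hk) hden'
    have hev : ∀ x : ℂ, (x - a) * (x - b) = (x - a') * (x - b') := fun x => by
      simpa using congrArg (eval x) hpoly
    have hs : a + b = a' + b' := by linear_combination hev 0 - hev 1
    have ha := hev a'
    rw [sub_self, zero_mul, mul_eq_zero, sub_eq_zero, sub_eq_zero] at ha
    -- The poles attached to `Y₁`, `Y₂` are `a`, `b` up to order; in the second case the factor
    -- roots are swapped.
    rcases ha with rfl | rfl
    · obtain rfl : b = b' := by linear_combination hs
      exact ⟨Y₁, Y₂, h, h₁, h₂⟩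
    · obtain rfl : a = b' := by linear_combination hs
      exact ⟨Y₂, Y₁, h.symm, h₂, h₁⟩
  · rintro ⟨Y₁, Y₂, h, h₁, h₂⟩
    have hne : ∀ {x Y : ℂ}, Y ^ 2 + x * Y + c = 0 → Y ≠ 0 := by
      rintro x Y h rfl
      simp [hc0] at h
    have hY : Y₁ * Y₂ ≠ 0 := mul_ne_zero (hne h₁) (hne h₂)
    refine ⟨_, ?_, h.denom_eq h₁ h₂ hc hY⟩
    intro h0
    rw [h.2, h0, zero_mul] at hY
    exact hY rfl

theorem root_eq_or {c : ℝ} {a y Y : ℂ} (hy : y ≠ 0) (h : y ^ 2 + a * y + c = 0)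
    (H : Y ^ 2 + a * Y + c = 0) : Y = y ∨ Y = c / y := by
  have h1 : (Y - y) * (Y * y - c) = 0 := by linear_combination y * H - Y * h
  rcases mul_eq_zero.1 h1 with h1 | h1
  · exact Or.inl (sub_eq_zero.1 h1)
  · right; rw [eq_div_iff hy]; linear_combination h1

/-- A measure is represented by at most one pair. -/
theorem represents_unique {c : ℝ} (hc : 0 < c) {μ : Measure ℝ} {p q : ℝ × ℝ}
    (hp : Represents c p μ) (hq : Represents c q μ) : p = q := by
  have key : ∀ w : ℂ, w.im ≠ 0 → (p.1 : ℂ) - q.1 = 2 * (p.2 - q.2) * rho c w := by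
    intro w hw
    have h := (hp w hw).trans (hq w hw).symm
    simp only [oneShift, shift, one_div, inv_inj] at h
    linear_combination h
  -- Two points suffice: a common value of `ρ` at `I` and `2 * I` would satisfy both quadratics and
  -- so vanish.
  have hI : (Complex.I).im ≠ 0 := by simp
  have hI2 : (2 * Complex.I).im ≠ 0 := by simp
  obtain ⟨r1, l1⟩ := rho_spec hc hI
  obtain ⟨r2, l2⟩ := rho_spec hc hI2
  have hne : rho c Complex.I - rho c (2 * Complex.I) ≠ 0 := by
    intro h
    rw [← sub_eq_zero.1 h] at r2
    have h0 : Complex.I * rho c Complex.I = 0 := by linear_combination r2 - r1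
    exact IsInnerRoot.ne_zero ⟨r1, Or.inl l1⟩ hc (by simpa using h0)
  have h2 : (p.2 : ℂ) - q.2 = 0 := by
    have : ((p.2 : ℂ) - q.2) * (rho c Complex.I - rho c (2 * Complex.I)) = 0 := by
      linear_combination (key _ hI2 - key _ hI) / 2
    exact (mul_eq_zero.1 this).resolve_right hne
  have h1 : (p.1 : ℂ) - q.1 = 0 := by rw [key _ hI, h2]; ring
  exact Prod.ext (by exact_mod_cast sub_eq_zero.1 h1) (by exact_mod_cast sub_eq_zero.1 h2)

/-! ### Real factor roots: counting the admissible flips -/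

/-- The pair `(α, β)` with real factor roots `Y₁, Y₂`. -/
noncomputable def factorPoint (c Y₁ Y₂ : ℝ) : ℝ × ℝ :=
  (-(Y₁ + Y₂), (1 - Y₁ * Y₂ / c) / 2)

theorem factorPoint_hasFactorRoots {c : ℝ} (hc : 0 < c) (Y₁ Y₂ : ℝ) :
    HasFactorRoots c (factorPoint c Y₁ Y₂) Y₁ Y₂ := by
  have hc0 : (c : ℂ) ≠ 0 := by exact_mod_cast hc.ne'
  constructor
  · simp [factorPoint]
  · simp only [factorPoint]
    push_cast
    field_simp
    ring

theorem factorPoint_comm (c Y₁ Y₂ : ℝ) : factorPoint c Y₁ Y₂ = factorPoint c Y₂ Y₁ := by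
  rw [factorPoint, factorPoint, add_comm, mul_comm]

theorem factorPoint_left_inj {c Y Y' Z : ℝ} : factorPoint c Y Z = factorPoint c Y' Z ↔ Y = Y' := by
  refine ⟨fun h => ?_, fun h => by rw [h]⟩
  have := congrArg Prod.fst h
  simp only [factorPoint] at this
  linarith

theorem factorPoint_right_inj {c Y Z Z' : ℝ} :
    factorPoint c Y Z = factorPoint c Y Z' ↔ Z = Z' := by
  rw [factorPoint_comm c Y, factorPoint_comm c Y, factorPoint_left_inj]

theorem factorPoint_snd_pos {c Y₁ Y₂ : ℝ} (hc : 0 < c) :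
    0 < (factorPoint c Y₁ Y₂).2 ↔ Y₁ * Y₂ < c := by
  simp only [factorPoint]
  rw [div_pos_iff_of_pos_right two_pos, sub_pos, div_lt_one hc]

theorem div_eq_self_iff {c y : ℝ} (hy : y ≠ 0) : c / y = y ↔ y ^ 2 = c := by
  rw [div_eq_iff hy, pow_two, eq_comm]

/-- The positive pairs, other than the inner one, whose factor roots are each `yᵢ` or `c / yᵢ`. -/
def outerPoints (c y₁ y₂ : ℝ) : Set (ℝ × ℝ) :=
  {p | 0 < p.2 ∧ p ≠ factorPoint c y₁ y₂ ∧ (p = factorPoint c (c / y₁) y₂ ∨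
    p = factorPoint c y₁ (c / y₂) ∨ p = factorPoint c (c / y₁) (c / y₂))}

theorem outerPoints_comm (c y₁ y₂ : ℝ) : outerPoints c y₁ y₂ = outerPoints c y₂ y₁ := by
  ext p
  simp only [outerPoints, Set.mem_ofPred_eq, factorPoint_comm c y₁, factorPoint_comm c (c / y₁)]
  tauto

section Counting

variable {c y₁ y₂ : ℝ}

/-- Decides `β > 0` after the flip of one root `y₁` to `c / y₁`. -/
theorem div_mul_lt_iff (hc : 0 < c) (h₁ : y₁ ≠ 0) : c / y₁ * y₂ < c ↔ y₁ * y₂ < y₁ ^ 2 := by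
  have h : 0 < y₁ ^ 2 := by positivity
  rw [← mul_lt_mul_iff_of_pos_right h, ← mul_lt_mul_iff_of_pos_left hc (c := y₁ ^ 2)]
  rw [show c / y₁ * y₂ * y₁ ^ 2 = c * (y₁ * y₂) by field_simp]

theorem div_mul_div_lt_iff (hc : 0 < c) (h₁ : y₁ ≠ 0) (h₂ : y₂ ≠ 0) (hle : y₁ * y₂ ≤ c) :
    c / y₁ * (c / y₂) < c ↔ y₁ * y₂ < 0 := by
  have h0 : y₁ * y₂ ≠ 0 := mul_ne_zero h₁ h₂
  rw [div_mul_div_comm]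
  constructor
  · intro h
    by_contra! hn
    have hp : 0 < y₁ * y₂ := lt_of_le_of_ne hn h0.symm
    rw [div_lt_iff₀ hp] at h
    nlinarith
  · intro h
    exact (div_neg_of_pos_of_neg (by positivity) h).trans hc

theorem mem_outerPoints_left (hc : 0 < c) (h₁ : y₁ ≠ 0) :
    factorPoint c (c / y₁) y₂ ∈ outerPoints c y₁ y₂ ↔ y₁ * y₂ < y₁ ^ 2 ∧ y₁ ^ 2 ≠ c := by
  simp [outerPoints, factorPoint_snd_pos hc, div_mul_lt_iff hc h₁, factorPoint_left_inj,
    div_eq_self_iff h₁]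

theorem mem_outerPoints_right (hc : 0 < c) (h₂ : y₂ ≠ 0) :
    factorPoint c y₁ (c / y₂) ∈ outerPoints c y₁ y₂ ↔ y₁ * y₂ < y₂ ^ 2 ∧ y₂ ^ 2 ≠ c := by
  rw [factorPoint_comm, outerPoints_comm, mem_outerPoints_left hc h₂, mul_comm]

theorem factorPoint_div_div_eq_iff (hc : 0 < c) (h₁ : y₁ ≠ 0) (h₂ : y₂ ≠ 0) (hs₁ : y₁ ^ 2 ≤ c)
    (hs₂ : y₂ ^ 2 ≤ c) : factorPoint c (c / y₁) (c / y₂) = factorPoint c y₁ y₂ ↔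
      y₁ ^ 2 = c ∧ y₂ ^ 2 = c := by
  constructor
  · intro h
    have := congrArg Prod.snd h
    simp only [factorPoint] at this
    field_simp at this
    have h3 : c ^ 2 = y₁ ^ 2 * y₂ ^ 2 := by linarith
    have := sq_pos_of_ne_zero h₁
    have := sq_pos_of_ne_zero h₂
    constructor <;> nlinarith
  · rintro ⟨e₁, e₂⟩
    rw [(div_eq_self_iff h₁).2 e₁, (div_eq_self_iff h₂).2 e₂]

theorem mul_le_of_sq_le (hs₁ : y₁ ^ 2 ≤ c) (hs₂ : y₂ ^ 2 ≤ c) : y₁ * y₂ ≤ c := by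
  nlinarith [sq_nonneg (y₁ - y₂)]

theorem mem_outerPoints_both (hc : 0 < c) (h₁ : y₁ ≠ 0) (h₂ : y₂ ≠ 0) (hs₁ : y₁ ^ 2 ≤ c)
    (hs₂ : y₂ ^ 2 ≤ c) : factorPoint c (c / y₁) (c / y₂) ∈ outerPoints c y₁ y₂ ↔
      y₁ * y₂ < 0 ∧ ¬ (y₁ ^ 2 = c ∧ y₂ ^ 2 = c) := by
  simp only [outerPoints, Set.mem_ofPred_eq, factorPoint_snd_pos hc,
    div_mul_div_lt_iff hc h₁ h₂ (mul_le_of_sq_le hs₁ hs₂), ne_eq,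
    factorPoint_div_div_eq_iff hc h₁ h₂ hs₁ hs₂, or_true, and_true]

theorem eq_of_mem_outerPoints {p : ℝ × ℝ} (h : p ∈ outerPoints c y₁ y₂) :
    p = factorPoint c (c / y₁) y₂ ∨ p = factorPoint c y₁ (c / y₂) ∨
      p = factorPoint c (c / y₁) (c / y₂) := h.2.2

theorem outerPoints_encard_of_lt (hc : 0 < c) (h₁ : y₁ ≠ 0) (h₂ : y₂ ≠ 0) (hs₁ : y₁ ^ 2 < c)
    (hs₂ : y₂ ^ 2 < c) (h : y₁ * y₂ < y₁ ^ 2) (hpos : 0 < y₁ * y₂) :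
    (outerPoints c y₁ y₂).encard = 1 := by
  rw [Set.encard_eq_one]
  refine ⟨factorPoint c (c / y₁) y₂, Set.eq_singleton_iff_unique_mem.2
    ⟨(mem_outerPoints_left hc h₁).2 ⟨h, hs₁.ne⟩, fun p hp => ?_⟩⟩
  rcases eq_of_mem_outerPoints hp with rfl | rfl | rfl
  · rfl
  · have h3 := ((mem_outerPoints_right hc h₂).1 hp).1
    nlinarith
  · have h3 := ((mem_outerPoints_both hc h₁ h₂ hs₁.le hs₂.le).1 hp).1
    linarith

/-- For equal signs, `y₁ y₂ < y₁ ^ 2` says `|y₂| < |y₁|`: only the root of larger modulus can be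
flipped, and never both. -/
theorem outerPoints_encard_of_pos (hc : 0 < c) (h₁ : y₁ ≠ 0) (h₂ : y₂ ≠ 0) (hs₁ : y₁ ^ 2 < c)
    (hs₂ : y₂ ^ 2 < c) (hne : y₁ ≠ y₂) (hpos : 0 < y₁ * y₂) :
    (outerPoints c y₁ y₂).encard = 1 := by
  rcases lt_or_ge (y₁ * y₂) (y₁ ^ 2) with h | h
  · exact outerPoints_encard_of_lt hc h₁ h₂ hs₁ hs₂ h hpos
  · rw [outerPoints_comm]
    refine outerPoints_encard_of_lt hc h₂ h₁ hs₂ hs₁ ?_ (by rwa [mul_comm])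
    nlinarith [sq_pos_of_ne_zero (sub_ne_zero.2 hne)]

theorem outerPoints_encard_of_neg (hc : 0 < c) (h₁ : y₁ ≠ 0) (h₂ : y₂ ≠ 0) (hs₁ : y₁ ^ 2 < c)
    (hs₂ : y₂ ^ 2 < c) (hneg : y₁ * y₂ < 0) : (outerPoints c y₁ y₂).encard = 3 := by
  rw [Set.encard_eq_three]
  refine ⟨factorPoint c (c / y₁) y₂, factorPoint c y₁ (c / y₂), factorPoint c (c / y₁) (c / y₂),
    ?_, ?_, ?_, ?_⟩
  · intro h
    have e1 := congrArg Prod.fst h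
    have e2 := congrArg Prod.snd h
    simp only [factorPoint] at e1 e2
    field_simp at e1 e2
    -- Equal `β` forces `y₁ = ± y₂`. The sign condition excludes `y₁ = y₂`, and for `y₂ = -y₁` equal
    -- `α` would give `y₁ ^ 2 = c`.
    have e3 : (y₁ - y₂) * (y₁ + y₂) = 0 := by linarith
    rcases mul_eq_zero.1 e3 with e | e
    · obtain rfl : y₁ = y₂ := by linarith
      nlinarith [sq_nonneg y₁]
    · obtain rfl : y₂ = -y₁ := by linarith
      have : y₁ * (y₁ ^ 2 - c) = 0 := by linear_combination -e1 / 2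
      rcases mul_eq_zero.1 this with e | e
      · exact h₁ e
      · linarith
  · rw [ne_eq, factorPoint_right_inj, eq_comm, div_eq_self_iff h₂]
    exact hs₂.ne
  · rw [ne_eq, factorPoint_left_inj, eq_comm, div_eq_self_iff h₁]
    exact hs₁.ne
  · ext p
    simp only [Set.mem_insert_iff, Set.mem_singleton_iff]
    refine ⟨eq_of_mem_outerPoints, ?_⟩
    rintro (rfl | rfl | rfl)
    · exact (mem_outerPoints_left hc h₁).2 ⟨by nlinarith [sq_nonneg y₁], hs₁.ne⟩
    · exact (mem_outerPoints_right hc h₂).2 ⟨by nlinarith [sq_nonneg y₂], hs₂.ne⟩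
    · exact (mem_outerPoints_both hc h₁ h₂ hs₁.le hs₂.le).2 ⟨hneg, fun h => hs₁.ne h.1⟩

/-- A single flip gives `Y₁ Y₂ = c`, that is `β = 0`; a double flip gives `c ^ 2 / y₁ ^ 2 ≥ c`. -/
theorem outerPoints_self (hc : 0 < c) (h₁ : y₁ ≠ 0) (hs₁ : y₁ ^ 2 ≤ c) :
    outerPoints c y₁ y₁ = ∅ := by
  refine Set.eq_empty_iff_forall_notMem.2 fun p hp => ?_
  rcases eq_of_mem_outerPoints hp with rfl | rfl | rfl
  · have := ((mem_outerPoints_left hc h₁).1 hp).1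
    nlinarith
  · have := ((mem_outerPoints_right hc h₁).1 hp).1
    nlinarith
  · have := ((mem_outerPoints_both hc h₁ h₁ hs₁ hs₁).1 hp).1
    nlinarith

theorem outerPoints_eq_empty_of_pos (hc : 0 < c) (h₁ : y₁ ≠ 0) (h₂ : y₂ ≠ 0) (hs₁ : y₁ ^ 2 = c)
    (hs₂ : y₂ ^ 2 ≤ c) (hpos : 0 < y₁ * y₂) : outerPoints c y₁ y₂ = ∅ := by
  refine Set.eq_empty_iff_forall_notMem.2 fun p hp => ?_
  rcases eq_of_mem_outerPoints hp with rfl | rfl | rfl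
  · exact ((mem_outerPoints_left hc h₁).1 hp).2 hs₁
  · have := ((mem_outerPoints_right hc h₂).1 hp).1
    have h3 : (y₁ * y₂) ^ 2 < (y₂ ^ 2) ^ 2 := by
      exact pow_lt_pow_left₀ this hpos.le two_ne_zero
    have h4 := sq_pos_of_ne_zero h₂
    rw [mul_pow] at h3
    nlinarith
  · have := ((mem_outerPoints_both hc h₁ h₂ hs₁.le hs₂).1 hp).1
    linarith

theorem outerPoints_eq_empty_of_sq_eq (hc : 0 < c) (h₁ : y₁ ≠ 0) (h₂ : y₂ ≠ 0) (hs₁ : y₁ ^ 2 = c)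
    (hs₂ : y₂ ^ 2 = c) : outerPoints c y₁ y₂ = ∅ := by
  refine Set.eq_empty_iff_forall_notMem.2 fun p hp => ?_
  rcases eq_of_mem_outerPoints hp with rfl | rfl | rfl
  · exact ((mem_outerPoints_left hc h₁).1 hp).2 hs₁
  · exact ((mem_outerPoints_right hc h₂).1 hp).2 hs₂
  · exact ((mem_outerPoints_both hc h₁ h₂ hs₁.le hs₂.le).1 hp).2 ⟨hs₁, hs₂⟩

/-- The flip fixes `y₁`, so the four candidates collapse to two: the inner pair and the pair with
`y₂` flipped. -/
theorem outerPoints_encard_of_sq_eq (hc : 0 < c) (h₁ : y₁ ≠ 0) (h₂ : y₂ ≠ 0) (hs₁ : y₁ ^ 2 = c)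
    (hs₂ : y₂ ^ 2 < c) (hneg : y₁ * y₂ < 0) : (outerPoints c y₁ y₂).encard = 1 := by
  rw [Set.encard_eq_one]
  refine ⟨factorPoint c y₁ (c / y₂), Set.eq_singleton_iff_unique_mem.2
    ⟨(mem_outerPoints_right hc h₂).2 ⟨by nlinarith [sq_nonneg y₂], hs₂.ne⟩, fun p hp => ?_⟩⟩
  rcases eq_of_mem_outerPoints hp with rfl | rfl | rfl
  · exact absurd hs₁ ((mem_outerPoints_left hc h₁).1 hp).2
  · rfl
  · rw [(div_eq_self_iff h₁).2 hs₁]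

end Counting

/-! ### Translating conditions on real roots of `Q` to inner roots -/

theorem exists_inner_root_of_pos {c x : ℝ} (hc : 0 < c) (hx : 0 < x) (h : 4 * c ≤ x ^ 2) :
    ∃ y : ℝ, y ^ 2 + x * y + c = 0 ∧ y ^ 2 ≤ c := by
  have hq := Real.sq_sqrt (sub_nonneg.2 h)
  have hq0 := Real.sqrt_nonneg (x ^ 2 - 4 * c)
  set q := √(x ^ 2 - 4 * c)
  refine ⟨(-x + q) / 2, by linear_combination hq / 4, ?_⟩
  have : q ≤ x := by nlinarith
  nlinarith

theorem exists_inner_root {c x : ℝ} (hc : 0 < c) (h : 4 * c ≤ x ^ 2) :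
    ∃ y : ℝ, y ^ 2 + x * y + c = 0 ∧ y ^ 2 ≤ c := by
  rcases lt_trichotomy x 0 with hx | rfl | hx
  · obtain ⟨y, h1, h2⟩ := exists_inner_root_of_pos hc (neg_pos.2 hx) (by rwa [neg_sq])
    exact ⟨-y, by linear_combination h1, by rwa [neg_sq]⟩
  · simp at h; linarith
  · exact exists_inner_root_of_pos hc hx h

theorem isInnerRoot_ofReal {c x y : ℝ} (h : y ^ 2 + x * y + c = 0) (hy : y ^ 2 ≤ c) :
    IsInnerRoot c x y := by
  refine ⟨by exact_mod_cast h, ?_⟩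
  rcases hy.lt_or_eq with hlt | heq
  · left
    rw [Complex.norm_real, Real.norm_eq_abs]
    exact (Real.lt_sqrt (abs_nonneg y)).2 (by rwa [sq_abs])
  · right
    exact_mod_cast heq

theorem four_mul_le_sq_of_forall_ne {c x : ℝ} (hc : 0 < c)
    (h : ∀ t ∈ Set.Ioo (-(2 * √c)) (2 * √c), (t : ℂ) - (x : ℂ) ≠ 0) : 4 * c ≤ x ^ 2 := by
  by_contra! hlt
  refine h x ?_ (sub_self _)
  have h2 : x ^ 2 < (2 * √c) ^ 2 := by
    rw [mul_pow, Real.sq_sqrt hc.le]; linarith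
  exact abs_lt.1 (abs_lt_of_sq_lt_sq h2 (by positivity))

/-- From `x = -(y + c / y)` one gets `x² - 4c = (y - c / y)²`. -/
theorem sq_eq_four_mul_iff {c x y : ℝ} (h : y ^ 2 + x * y + c = 0) (hy : y ≠ 0) :
    x ^ 2 = 4 * c ↔ y ^ 2 = c := by
  have key : y ^ 2 * (x ^ 2 - 4 * c) = (y ^ 2 - c) ^ 2 := by
    linear_combination (x * y - y ^ 2 - c) * h
  constructor
  · intro e
    rw [e, sub_self, mul_zero, eq_comm, sq_eq_zero_iff] at key
    linarith
  · intro e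
    rw [e, sub_self, zero_pow two_ne_zero, mul_eq_zero] at key
    rcases key with k | k
    · exact absurd (by rwa [← e, sq_eq_zero_iff] at k) hy
    · linarith

/-- `x = -(y² + c) / y` has the sign opposite to `y`, and two sign changes cancel in the product. -/
theorem mul_pos_iff_of_roots {c x x' y y' : ℝ} (hc : 0 < c) (h : y ^ 2 + x * y + c = 0)
    (h' : y' ^ 2 + x' * y' + c = 0) : (0 < x * x' ↔ 0 < y * y') ∧ (x * x' < 0 ↔ y * y' < 0) := by
  have key : (x * x') * (y * y') = (y ^ 2 + c) * (y' ^ 2 + c) := by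
    linear_combination (x' * y') * h - (y ^ 2 + c) * h'
  have hpos : 0 < (x * x') * (y * y') := by rw [key]; positivity
  rcases mul_pos_iff.1 hpos with ⟨h1, h2⟩ | ⟨h1, h2⟩
  · exact ⟨by simp [h1, h2], by constructor <;> intro <;> linarith⟩
  · exact ⟨by constructor <;> intro <;> linarith, by simp [h1, h2]⟩

theorem isPositiveSolution_ofReal_iff {c x₁ x₂ y₁ y₂ : ℝ} (hc : 0 < c) (hy₁ : y₁ ≠ 0)
    (hy₂ : y₂ ≠ 0) (h₁ : y₁ ^ 2 + x₁ * y₁ + c = 0) (h₂ : y₂ ^ 2 + x₂ * y₂ + c = 0) {p : ℝ × ℝ} :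
    IsPositiveSolution c x₁ x₂ p ↔ 0 < p.2 ∧ (p = factorPoint c y₁ y₂ ∨
      p = factorPoint c (c / y₁) y₂ ∨ p = factorPoint c y₁ (c / y₂) ∨
      p = factorPoint c (c / y₁) (c / y₂)) := by
  rw [isPositiveSolution_iff hc]
  refine and_congr_right fun _ => ⟨?_, ?_⟩
  · rintro ⟨Y₁, Y₂, h, r₁, r₂⟩
    have o₁ := root_eq_or (y := (y₁ : ℂ)) (by exact_mod_cast hy₁) (by exact_mod_cast h₁) r₁
    have o₂ := root_eq_or (y := (y₂ : ℂ)) (by exact_mod_cast hy₂) (by exact_mod_cast h₂) r₂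
    rw [← Complex.ofReal_div] at o₁ o₂
    rcases o₁ with rfl | rfl <;> rcases o₂ with rfl | rfl
    · exact Or.inl (h.unique hc (factorPoint_hasFactorRoots hc _ _))
    · exact Or.inr (Or.inr (Or.inl (h.unique hc (factorPoint_hasFactorRoots hc _ _))))
    · exact Or.inr (Or.inl (h.unique hc (factorPoint_hasFactorRoots hc _ _)))
    · exact Or.inr (Or.inr (Or.inr (h.unique hc (factorPoint_hasFactorRoots hc _ _))))
  · have inv : ∀ {x y : ℝ}, y ≠ 0 → y ^ 2 + x * y + c = 0 →
        (c / y) ^ 2 + x * (c / y) + c = 0 := by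
      intro x y hy h
      field_simp
      linear_combination c * h
    have i₁ := inv hy₁ h₁
    have i₂ := inv hy₂ h₂
    rintro (rfl | rfl | rfl | rfl)
    all_goals exact ⟨_, _, factorPoint_hasFactorRoots hc _ _, by exact_mod_cast ‹_›,
      by exact_mod_cast ‹_›⟩

/-- The pair with factor roots `y₁, y₂` represents a measure with the matching transform. -/
theorem HasFactorRoots.represents {c : ℝ} (hc : 0 < c) {p : ℝ × ℝ} {y₁ y₂ : ℂ}
    (h : HasFactorRoots c p y₁ y₂) {μ : Measure ℝ}
    (hμ : ∀ w : ℂ, w.im ≠ 0 → stieltjes μ w =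
      c * rho c w / ((c - rho c w * y₁) * (c - rho c w * y₂))) : Represents c p μ := by
  intro w hw
  rw [hμ w hw, h.oneShift_eq hc hw]

theorem extraSolutions_eq {c : ℝ} (hc : 0 < c) {a b : ℂ} {μ : Measure ℝ} {p₀ : ℝ × ℝ}
    (h : Represents c p₀ μ) :
    extraSolutions c a b μ = {p | IsPositiveSolution c a b p ∧ p ≠ p₀} := by
  ext p
  refine and_congr_right fun _ => not_congr ⟨fun hp => represents_unique hc hp h, ?_⟩
  rintro rfl
  exact h

/-! ### Measures with atoms for the flipped pairs -/

section Atoms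

variable {c x₁ x₂ y₁ y₂ : ℝ}

theorem one_div_sub_eq {x y : ℝ} (hc : 0 < c) (h : y ^ 2 + x * y + c = 0) {w : ℂ} (hw : w.im ≠ 0) :
    (y : ℂ) - rho c w ≠ 0 ∧ (c : ℂ) - rho c w * y ≠ 0 ∧
      1 / ((x : ℂ) - w) = y * rho c w / ((y - rho c w) * (c - rho c w * y)) := by
  obtain ⟨hr, hlt⟩ := rho_spec hc hw
  have hρ := IsInnerRoot.ne_zero ⟨hr, Or.inl hlt⟩ hc
  have hy : (y : ℂ) ≠ 0 := by
    rintro h0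
    rw [Complex.ofReal_eq_zero.1 h0] at h
    simp at h
    exact hc.ne' h
  have hxw := ofReal_sub_ne_zero_of_im_ne_zero hw x
  have key := sub_mul_eq (a := (x : ℂ)) (y₁ := (y : ℂ)) (by exact_mod_cast h) hr
  rw [mul_comm (y : ℂ) (rho c w)] at key
  have hne : ((y : ℂ) - rho c w) * (c - rho c w * y) ≠ 0 := by
    rw [← key]
    exact mul_ne_zero hxw (mul_ne_zero hρ hy)
  refine ⟨left_ne_zero_of_mul hne, right_ne_zero_of_mul hne, ?_⟩
  rw [div_eq_div_iff hxw hne]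
  linear_combination -key

/-- `S_{α,β}` is the Stieltjes transform of a probability measure `κ μ + u δ_x + v δ_{x'}` with
atoms. -/
def RepresentsWithAtoms (c : ℝ) (p : ℝ × ℝ) (μ : Measure ℝ) (x x' : ℝ) : Prop :=
  ∃ κ u v : ℝ≥0, 0 < κ ∧ (0 < u ∨ 0 < v) ∧
    IsProbabilityMeasure (κ • μ + u • Measure.dirac x + v • Measure.dirac x') ∧
    Represents c p (κ • μ + u • Measure.dirac x + v • Measure.dirac x')

theorem RepresentsWithAtoms.symm {p : ℝ × ℝ} {μ : Measure ℝ} {x x' : ℝ}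
    (h : RepresentsWithAtoms c p μ x x') : RepresentsWithAtoms c p μ x' x := by
  obtain ⟨κ, u, v, hκ, huv, h1, h2⟩ := h
  rw [add_right_comm] at h1 h2
  exact ⟨κ, v, u, hκ, huv.symm, h1, h2⟩

theorem RepresentsWithAtoms.of_real {p : ℝ × ℝ} {μ : Measure ℝ} [IsProbabilityMeasure μ]
    {x x' κ u v : ℝ} (hκ : 0 < κ) (hu : 0 ≤ u) (hv : 0 ≤ v) (huv : 0 < u ∨ 0 < v)
    (hsum : κ + u + v = 1) (h : ∀ w : ℂ, w.im ≠ 0 → oneShift c p.1 p.2 w =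
      κ * stieltjes μ w + u * (1 / (x - w)) + v * (1 / (x' - w))) :
    RepresentsWithAtoms c p μ x x' := by
  lift κ to ℝ≥0 using hκ.le
  lift u to ℝ≥0 using hu
  lift v to ℝ≥0 using hv
  exact ⟨κ, u, v, by exact_mod_cast hκ, by exact_mod_cast huv,
    isProbabilityMeasure_add_atoms μ x x' (by exact_mod_cast hsum),
    fun w hw => by rw [stieltjes_add_atoms _ _ _ _ _ _ hw, h w hw]⟩

theorem sub_mul_div_eq {y : ℝ} (hy : y ≠ 0) (z : ℂ) :
    (c : ℂ) - z * ((c / y : ℝ) : ℂ) = c * (y - z) / y := by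
  have hy0 : (y : ℂ) ≠ 0 := by exact_mod_cast hy
  push_cast
  field_simp

theorem representsWithAtoms_left (hc : 0 < c) (hy₁ : y₁ ≠ 0) (h₁ : y₁ ^ 2 + x₁ * y₁ + c = 0)
    (h₂ : y₂ ^ 2 + x₂ * y₂ + c = 0) {μ : Measure ℝ} [IsProbabilityMeasure μ]
    (hμ : ∀ w : ℂ, w.im ≠ 0 → stieltjes μ w =
      c * rho c w / ((c - rho c w * y₁) * (c - rho c w * y₂)))
    (hs₁ : y₁ ^ 2 < c) (hpos : y₁ * y₂ < y₁ ^ 2) :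
    RepresentsWithAtoms c (factorPoint c (c / y₁) y₂) μ x₁ x₂ := by
  have hd : 0 < c - y₁ * y₂ := by linarith
  -- The pole at `ρ = y₁` fixes `u`, and `κ = 1 - u`. Here `κ > 0` is the condition `β > 0`, and `u
  -- > 0` is `y₁ ^ 2 < c`.
  refine .of_real (κ := (y₁ ^ 2 - y₁ * y₂) / (c - y₁ * y₂)) (u := (c - y₁ ^ 2) / (c - y₁ * y₂))
    (v := 0) (div_pos (by linarith) hd) (div_nonneg (by linarith) hd.le) le_rfl
    (Or.inl (div_pos (by linarith) hd)) (by field_simp; ring) fun w hw => ?_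
  rw [hμ w hw, (factorPoint_hasFactorRoots hc _ _).oneShift_eq hc hw]
  obtain ⟨n1, n2, e1⟩ := one_div_sub_eq hc h₁ hw
  obtain ⟨-, n4, -⟩ := one_div_sub_eq hc h₂ hw
  have hc0 : (c : ℂ) ≠ 0 := by exact_mod_cast hc.ne'
  have hy0 : (y₁ : ℂ) ≠ 0 := by exact_mod_cast hy₁
  have hd0 : (c : ℂ) - y₁ * y₂ ≠ 0 := by exact_mod_cast hd.ne'
  rw [e1, sub_mul_div_eq hy₁]
  generalize rho c w = y at *
  push_cast
  field_simp
  ring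

theorem representsWithAtoms_both (hc : 0 < c) (hy₁ : y₁ ≠ 0) (hy₂ : y₂ ≠ 0)
    (h₁ : y₁ ^ 2 + x₁ * y₁ + c = 0)
    (h₂ : y₂ ^ 2 + x₂ * y₂ + c = 0) {μ : Measure ℝ} [IsProbabilityMeasure μ]
    (hμ : ∀ w : ℂ, w.im ≠ 0 → stieltjes μ w =
      c * rho c w / ((c - rho c w * y₁) * (c - rho c w * y₂)))
    (hs₁ : y₁ ^ 2 ≤ c) (hs₂ : y₂ ^ 2 ≤ c) (hne : ¬ (y₁ ^ 2 = c ∧ y₂ ^ 2 = c))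
    (hneg : y₁ * y₂ < 0) :
    RepresentsWithAtoms c (factorPoint c (c / y₁) (c / y₂)) μ x₁ x₂ := by
  have hd : y₁ - y₂ ≠ 0 := by
    intro h
    rw [sub_eq_zero.1 h] at hneg
    nlinarith [sq_nonneg y₂]
  have q₁ : 0 < y₁ / (y₁ - y₂) := by
    rw [← mul_div_mul_left _ _ hy₁]
    apply div_pos <;> nlinarith [sq_pos_of_ne_zero hy₁]
  have q₂ : 0 < -y₂ / (y₁ - y₂) := by
    rw [← mul_div_mul_left _ _ hy₁]
    apply div_pos <;> nlinarith [sq_pos_of_ne_zero hy₁]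
  -- The poles at `ρ = y₁` and `ρ = y₂` fix `u` and `v`, and `κ` is the remaining mass. An atom
  -- disappears when its root lies at an edge, which `hne` prevents for both at once.
  refine .of_real (κ := -(y₁ * y₂) / c) (u := -y₂ / (y₁ - y₂) * ((c - y₁ ^ 2) / c))
    (v := y₁ / (y₁ - y₂) * ((c - y₂ ^ 2) / c)) (div_pos (by linarith) hc)
    (mul_nonneg q₂.le (div_nonneg (by linarith) hc.le))
    (mul_nonneg q₁.le (div_nonneg (by linarith) hc.le)) ?_ (by field_simp; ring) fun w hw => ?_
  · rcases hs₁.lt_or_eq with h | h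
    · exact Or.inl (mul_pos q₂ (div_pos (by linarith) hc))
    · exact Or.inr (mul_pos q₁ (div_pos (sub_pos.2 (lt_of_le_of_ne hs₂ fun e => hne ⟨h, e⟩)) hc))
  rw [hμ w hw, (factorPoint_hasFactorRoots hc _ _).oneShift_eq hc hw]
  obtain ⟨n1, n2, e1⟩ := one_div_sub_eq hc h₁ hw
  obtain ⟨n3, n4, e2⟩ := one_div_sub_eq hc h₂ hw
  have hc0 : (c : ℂ) ≠ 0 := by exact_mod_cast hc.ne'
  have hy0 : (y₁ : ℂ) ≠ 0 := by exact_mod_cast hy₁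
  have hy0' : (y₂ : ℂ) ≠ 0 := by exact_mod_cast hy₂
  have hd0 : (y₁ : ℂ) - y₂ ≠ 0 := by exact_mod_cast hd
  rw [e1, e2, sub_mul_div_eq hy₁, sub_mul_div_eq hy₂]
  generalize rho c w = y at *
  push_cast
  field_simp
  ring

theorem representsWithAtoms_of_mem_outerPoints (hc : 0 < c) (hy₁ : y₁ ≠ 0) (hy₂ : y₂ ≠ 0)
    (h₁ : y₁ ^ 2 + x₁ * y₁ + c = 0)
    (h₂ : y₂ ^ 2 + x₂ * y₂ + c = 0) {μ : Measure ℝ} [IsProbabilityMeasure μ]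
    (hμ : ∀ w : ℂ, w.im ≠ 0 → stieltjes μ w =
      c * rho c w / ((c - rho c w * y₁) * (c - rho c w * y₂)))
    (hs₁ : y₁ ^ 2 ≤ c) (hs₂ : y₂ ^ 2 ≤ c) {p : ℝ × ℝ} (hp : p ∈ outerPoints c y₁ y₂) :
    RepresentsWithAtoms c p μ x₁ x₂ := by
  rcases eq_of_mem_outerPoints hp with rfl | rfl | rfl
  · obtain ⟨h3, h4⟩ := (mem_outerPoints_left hc hy₁).1 hp
    exact representsWithAtoms_left hc hy₁ h₁ h₂ hμ (lt_of_le_of_ne hs₁ h4) h3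
  · obtain ⟨h3, h4⟩ := (mem_outerPoints_right hc hy₂).1 hp
    rw [factorPoint_comm]
    refine (representsWithAtoms_left hc hy₂ h₂ h₁ (fun w hw => ?_) (lt_of_le_of_ne hs₂ h4)
      (by rwa [mul_comm])).symm
    rw [hμ w hw, mul_comm ((c : ℂ) - rho c w * y₁)]
  · obtain ⟨h3, h4⟩ := (mem_outerPoints_both hc hy₁ hy₂ hs₁ hs₂).1 hp
    exact representsWithAtoms_both hc hy₁ hy₂ h₁ h₂ hμ hs₁ hs₂ h4 h3

end Atoms

/-! ### Extra solutions in the real and the conjugate case -/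

theorem extraSolutions_ofReal {c x₁ x₂ y₁ y₂ : ℝ} (hc : 0 < c) (hy₁ : y₁ ≠ 0) (hy₂ : y₂ ≠ 0)
    (h₁ : y₁ ^ 2 + x₁ * y₁ + c = 0) (h₂ : y₂ ^ 2 + x₂ * y₂ + c = 0) {μ : Measure ℝ}
    (h : Represents c (factorPoint c y₁ y₂) μ) :
    extraSolutions c x₁ x₂ μ = outerPoints c y₁ y₂ := by
  ext p
  rw [extraSolutions_eq hc h]
  simp only [outerPoints, Set.mem_ofPred_eq, isPositiveSolution_ofReal_iff hc hy₁ hy₂ h₁ h₂]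
  tauto

/-- For non-real conjugate roots, the inner pair is the only positive solution. -/
theorem eq_of_isPositiveSolution_conj {c : ℝ} (hc : 0 < c) {a y : ℂ} (ha : a.im ≠ 0)
    (hy : IsInnerRoot c a y) {p p₀ : ℝ × ℝ} (h₀ : HasFactorRoots c p₀ y (starRingEnd ℂ y))
    (hp : IsPositiveSolution c a (starRingEnd ℂ a) p) : p = p₀ := by
  obtain ⟨hpos, Y₁, Y₂, h, r₁, r₂⟩ := (isPositiveSolution_iff hc).1 hp
  have hy0 := hy.ne_zero hc
  have hyc : starRingEnd ℂ y ≠ 0 := by simpa using hy0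
  have hroot : (starRingEnd ℂ y) ^ 2 + starRingEnd ℂ a * starRingEnd ℂ y + c = 0 := by
    have := congrArg (starRingEnd ℂ) hy.1
    simpa using this
  have hn : 0 < Complex.normSq y := Complex.normSq_pos.2 hy0
  have hle : Complex.normSq y ≤ c := by
    rw [Complex.normSq_eq_norm_sq]; exact hy.norm_sq_le hc
  have him : y.im ≠ 0 := by
    intro him
    have hyr : y = (y.re : ℂ) := Complex.ext rfl (by rw [him, Complex.ofReal_im])
    have h1 := congrArg Complex.im hy.1
    rw [hyr] at h1
    simp only [← Complex.ofReal_pow, Complex.add_im, Complex.mul_im, Complex.ofReal_im,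
      Complex.ofReal_re, Complex.zero_im] at h1
    have : a.im * y.re = 0 := by linarith
    rcases mul_eq_zero.1 this with h2 | h2
    · exact ha h2
    · exact hy0 (by rw [hyr, h2, Complex.ofReal_zero])
  -- The sum is `z * (1 + c / |z|²)`, a positive multiple of `z`. So one inner and one outer root
  -- would give a non-real `α`.
  have hmixed : ∀ z : ℂ, z.im ≠ 0 → 0 < Complex.normSq z →
      (z + c / starRingEnd ℂ z).im ≠ 0 := by
    intro z hz hzn h0
    rw [Complex.add_im, Complex.div_im] at h0
    simp only [Complex.ofReal_im, Complex.ofReal_re, Complex.conj_re, Complex.conj_im,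
      Complex.normSq_conj] at h0
    have : z.im * (1 + c / Complex.normSq z) = 0 := by linear_combination h0
    rcases mul_eq_zero.1 this with h1 | h1
    · exact hz h1
    · have : 0 < c / Complex.normSq z := by positivity
      linarith
  have hsumim : (Y₁ + Y₂).im = 0 := by
    have := congrArg Complex.im h.1
    rw [Complex.ofReal_im, Complex.neg_im] at this
    linarith
  rcases root_eq_or hy0 hy.1 r₁ with rfl | rfl <;> rcases root_eq_or hyc hroot r₂ with rfl | rfl
  · exact h.unique hc h₀
  · exact absurd hsumim (hmixed _ him hn)
  · refine absurd hsumim ?_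
    have := hmixed (starRingEnd ℂ y) (by simpa using him) (by simpa using hn)
    rwa [Complex.conj_conj, add_comm] at this
  -- For two outer roots `Y₁ Y₂ = c² / |y|² ≥ c`, contradicting `β > 0`.
  · exfalso
    have h2 := h.2
    rw [div_mul_div_comm, Complex.mul_conj, div_eq_iff (by exact_mod_cast hn.ne')] at h2
    have h3 : c * c = (1 - 2 * p.2) * c * Complex.normSq y := by exact_mod_cast h2
    have h4 : c = (1 - 2 * p.2) * Complex.normSq y :=
      mul_left_cancel₀ hc.ne' (by linarith)
    nlinarith [mul_pos hpos hn]

end SemicircularShift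

theorem mainTheorem5 (c : ℝ) (hc : 0 < c) (a b : ℂ)
    (hsum : (a + b).im = 0) (hprod : (a * b).im = 0)
    (N : ℝ) (hQ : ∀ t ∈ Set.Ioo (-(2 * √c)) (2 * √c), 0 < SemicircularShift.quad N a b t)
    (hfin : ¬ (a = b ∧ a ^ 2 = 4 * (c : ℂ)))
    (μ : MeasureTheory.Measure ℝ) (hμ : μ = SemicircularShift.quadMeasure c N a b)
    (E : Set (ℝ × ℝ)) (hE : E = SemicircularShift.extraSolutions c a b μ) :
    MeasureTheory.IsProbabilityMeasure μ ∧
    -- exactly one positive solution represents `μ`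
    (∃! p : ℝ × ℝ, SemicircularShift.IsPositiveSolution c a b p ∧
      SemicircularShift.Represents c p μ) ∧
    -- non-real roots
    (a.im ≠ 0 → E = ∅) ∧
    -- real roots, generic case
    (a.im = 0 → a ≠ b → a ^ 2 ≠ 4 * (c : ℂ) → b ^ 2 ≠ 4 * (c : ℂ) →
      (0 < (a * b).re → E.encard = 1) ∧ ((a * b).re < 0 → E.encard = 3)) ∧
    -- real roots, degenerate cases
    (a = b → E = ∅) ∧
    (a ≠ b → (a ^ 2 = 4 * (c : ℂ) ∨ b ^ 2 = 4 * (c : ℂ)) → 0 < (a * b).re → E = ∅) ∧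
    (Xor (a ^ 2 = 4 * (c : ℂ)) (b ^ 2 = 4 * (c : ℂ)) → (a * b).re < 0 → E.encard = 1) ∧
    (a ^ 2 = 4 * (c : ℂ) → b ^ 2 = 4 * (c : ℂ) → E = ∅) ∧
    -- the extra solutions come from measures with atoms
    (∀ p ∈ E, ∃ κ u v : NNReal, 0 < κ ∧ (0 < u ∨ 0 < v) ∧
      MeasureTheory.IsProbabilityMeasure
        (κ • μ + u • MeasureTheory.Measure.dirac a.re + v • MeasureTheory.Measure.dirac b.re) ∧
      SemicircularShift.Represents c p
        (κ • μ + u • MeasureTheory.Measure.dirac a.re + v • MeasureTheory.Measure.dirac b.re)) := by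
  subst hμ hE
  have hne : ∀ t ∈ Set.Ioo (-(2 * √c)) (2 * √c), (t : ℂ) - a ≠ 0 ∧ (t : ℂ) - b ≠ 0 :=
    fun t ht => SemicircularShift.sub_ne_zero_of_quad_pos (hQ t ht)
  by_cases ha : a.im = 0
  · have hb : b.im = 0 := by
      rw [Complex.add_im, ha, zero_add] at hsum
      exact hsum
    obtain ⟨x₁, rfl⟩ : ∃ x : ℝ, a = x := ⟨a.re, Complex.ext rfl (by rw [ha, Complex.ofReal_im])⟩
    obtain ⟨x₂, rfl⟩ : ∃ x : ℝ, b = x := ⟨b.re, Complex.ext rfl (by rw [hb, Complex.ofReal_im])⟩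
    obtain ⟨y₁, r₁, s₁⟩ := SemicircularShift.exists_inner_root hc
      (SemicircularShift.four_mul_le_sq_of_forall_ne hc fun t ht => (hne t ht).1)
    obtain ⟨y₂, r₂, s₂⟩ := SemicircularShift.exists_inner_root hc
      (SemicircularShift.four_mul_le_sq_of_forall_ne hc fun t ht => (hne t ht).2)
    have i₁ := SemicircularShift.isInnerRoot_ofReal r₁ s₁
    have i₂ := SemicircularShift.isInnerRoot_ofReal r₂ s₂
    have y₁0 : y₁ ≠ 0 := by exact_mod_cast i₁.ne_zero hc
    have y₂0 : y₂ ≠ 0 := by exact_mod_cast i₂.ne_zero hc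
    have q₁ := SemicircularShift.sq_eq_four_mul_iff r₁ y₁0
    have q₂ := SemicircularShift.sq_eq_four_mul_iff r₂ y₂0
    have q₁C : (x₁ : ℂ) ^ 2 = 4 * (c : ℂ) ↔ y₁ ^ 2 = c := by rw [← q₁]; norm_cast
    have q₂C : (x₂ : ℂ) ^ 2 = 4 * (c : ℂ) ↔ y₂ ^ 2 = c := by rw [← q₂]; norm_cast
    have hab : ¬ ((x₁ : ℂ) = x₂ ∧ (y₁ : ℂ) ^ 2 = c) := fun h =>
      hfin ⟨h.1, q₁C.2 (by exact_mod_cast h.2)⟩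
    have hxy : (x₁ : ℂ) = x₂ ↔ y₁ = y₂ := by
      constructor
      · intro h
        rw [h] at i₁
        exact_mod_cast i₁.unique hc i₂
      · rintro rfl
        have : y₁ * (x₁ - x₂) = 0 := by linear_combination r₁ - r₂
        exact_mod_cast sub_eq_zero.1 ((mul_eq_zero.1 this).resolve_left y₁0)
    have hlt : y₁ * y₂ < c := by
      refine lt_of_le_of_ne (SemicircularShift.mul_le_of_sq_le s₁ s₂) fun h => ?_
      refine i₁.sub_mul_ne_zero hc i₂ hab ?_
      rw [sub_eq_zero]
      exact_mod_cast h.symm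
    obtain ⟨hprob, hst⟩ := SemicircularShift.quadMeasure_spec hc hsum hprod hQ i₁ i₂ hab
    have hrep := (SemicircularShift.factorPoint_hasFactorRoots hc y₁ y₂).represents hc hst
    obtain ⟨sp, sn⟩ := SemicircularShift.mul_pos_iff_of_roots hc r₁ r₂
    have hre : ((x₁ : ℂ) * x₂).re = x₁ * x₂ := by simp
    -- All conditions on `x₁`, `x₂` are now conditions on `y₁`, `y₂`, and each claim becomes a count
    -- of `outerPoints`.
    rw [SemicircularShift.extraSolutions_ofReal hc y₁0 y₂0 r₁ r₂ hrep, q₁C, q₂C, hre, sp, sn,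
      hxy]
    refine ⟨hprob, ⟨SemicircularShift.factorPoint c y₁ y₂, ⟨?_, hrep⟩, ?_⟩, ?_, ?_, ?_, ?_, ?_, ?_,
      ?_⟩
    · exact (SemicircularShift.isPositiveSolution_ofReal_iff hc y₁0 y₂0 r₁ r₂).2
        ⟨(SemicircularShift.factorPoint_snd_pos hc).2 hlt, Or.inl rfl⟩
    · exact fun p hp => SemicircularShift.represents_unique hc hp.2 hrep
    · exact fun h => absurd ha h
    · intro _ h e₁ e₂
      have l₁ := lt_of_le_of_ne s₁ (mt q₁C.2 e₁)
      have l₂ := lt_of_le_of_ne s₂ (mt q₂C.2 e₂)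
      exact ⟨SemicircularShift.outerPoints_encard_of_pos hc y₁0 y₂0 l₁ l₂ (mt hxy.2 h),
        SemicircularShift.outerPoints_encard_of_neg hc y₁0 y₂0 l₁ l₂⟩
    · rintro rfl
      exact SemicircularShift.outerPoints_self hc y₁0 s₁
    · rintro _ (e | e) hpos
      · exact SemicircularShift.outerPoints_eq_empty_of_pos hc y₁0 y₂0 e s₂ hpos
      · rw [SemicircularShift.outerPoints_comm]
        exact SemicircularShift.outerPoints_eq_empty_of_pos hc y₂0 y₁0 e s₁ (by rwa [mul_comm])
    · rintro (⟨e, e'⟩ | ⟨e, e'⟩) hneg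
      · exact SemicircularShift.outerPoints_encard_of_sq_eq hc y₁0 y₂0 e (lt_of_le_of_ne s₂ e') hneg
      · rw [SemicircularShift.outerPoints_comm]
        exact SemicircularShift.outerPoints_encard_of_sq_eq hc y₂0 y₁0 e (lt_of_le_of_ne s₁ e')
          (by rwa [mul_comm])
    · exact SemicircularShift.outerPoints_eq_empty_of_sq_eq hc y₁0 y₂0
    · intro p hp
      exact SemicircularShift.representsWithAtoms_of_mem_outerPoints hc y₁0 y₂0 r₁ r₂ hst s₁ s₂ hp
  · obtain rfl : b = starRingEnd ℂ a := by
      rw [Complex.add_im] at hsum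
      rw [Complex.mul_im] at hprod
      refine Complex.ext ?_ (by rw [Complex.conj_im]; linarith)
      rw [Complex.conj_re]
      have : a.im * (b.re - a.re) = 0 := by linear_combination hprod - a.re * hsum
      exact sub_eq_zero.1 ((mul_eq_zero.1 this).resolve_left ha)
    have hane : a ≠ starRingEnd ℂ a := fun h => ha (Complex.conj_eq_iff_im.1 h.symm)
    obtain ⟨hr, hlt⟩ := SemicircularShift.rho_spec hc ha
    set y := SemicircularShift.rho c a
    have i₁ : SemicircularShift.IsInnerRoot c a y := ⟨hr, Or.inl hlt⟩
    have i₂ : SemicircularShift.IsInnerRoot c (starRingEnd ℂ a) (starRingEnd ℂ y) := by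
      refine ⟨?_, Or.inl (by rwa [RCLike.norm_conj])⟩
      have := congrArg (starRingEnd ℂ) hr
      simpa using this
    obtain ⟨hprob, hst⟩ := SemicircularShift.quadMeasure_spec hc hsum hprod hQ i₁ i₂
      fun h => hane h.1
    have hroots : SemicircularShift.HasFactorRoots c
        (-(2 * y.re), (1 - Complex.normSq y / c) / 2) y (starRingEnd ℂ y) := by
      have hc0 : (c : ℂ) ≠ 0 := by exact_mod_cast hc.ne'
      constructor
      · rw [Complex.add_conj]
        push_cast
        rfl
      · rw [Complex.mul_conj]
        push_cast
        field_simp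
        ring
    have hrep := hroots.represents hc hst
    have hlt' : Complex.normSq y < c := by
      rw [Complex.normSq_eq_norm_sq]
      exact (Real.lt_sqrt (norm_nonneg y)).1 hlt
    have hsol : SemicircularShift.IsPositiveSolution c a (starRingEnd ℂ a)
        (-(2 * y.re), (1 - Complex.normSq y / c) / 2) := by
      refine (SemicircularShift.isPositiveSolution_iff hc).2
        ⟨half_pos (sub_pos.2 ((div_lt_one hc).2 hlt')), _, _, hroots, i₁.1, i₂.1⟩
    have hE : SemicircularShift.extraSolutions c a (starRingEnd ℂ a)
        (SemicircularShift.quadMeasure c N a (starRingEnd ℂ a)) = ∅ := by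
      rw [SemicircularShift.extraSolutions_eq hc hrep]
      exact Set.eq_empty_iff_forall_notMem.2 fun p hp =>
        hp.2 (SemicircularShift.eq_of_isPositiveSolution_conj hc ha i₁ hroots hp.1)
    -- `a b = |a|²` makes the cases with `a b < 0` vacuous.
    have hmul : ¬ (a * starRingEnd ℂ a).re < 0 := by
      rw [Complex.mul_conj, Complex.ofReal_re]
      exact not_lt.2 (Complex.normSq_nonneg a)
    refine ⟨hprob, ⟨_, ⟨hsol, hrep⟩, fun p hp =>
      SemicircularShift.represents_unique hc hp.2 hrep⟩, fun _ => hE, fun h => absurd h ha,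
      fun _ => hE, fun _ _ _ => hE, fun _ h => absurd h hmul, fun _ _ => hE, ?_⟩
    rw [hE]
    exact fun p hp => absurd hp (Set.notMem_empty p)
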